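/- Let $M$ be a smooth manifold of dimension $n\ge 3$ and let $F\colon TM\to[0,\infty)$ be a Finsler metric, i.e. $F$ is continuous on $TM$, smooth on the complement of the zero section, satisfies $F(tv)=tF(v)$ for all $t>0$, and, with $E=\tfrac12F^2$, the matrix $g_{ij}=\frac{\partial^2E}{\partial y^i\partial y^j}$ is positive definite at every non-zero tangent vector; here $(x^i,y^i)$ are the coordinates on $TM$ induced by a local coordinate system of $M$. Let $$G^l=\tfrac12 g^{lm}\left(y^k\frac{\partial^2E}{\partial y^m\partial x^k}-\frac{\partial E}{\partial x^m}\right)$$ be the geodesic spray coefficients of $F$ and let $$P^l_{ijk}=-\frac{\partial^3G^l}{\partial y^i\partial y^j\partial y^k}$$ be the mixed curvature tensor of the Berwald connection of $F$. Let $\alpha\colon M\to\mathbb R$ be a smooth function and $p\in M$ a point with $d_p\alpha\ne0$. Assume that the indicatrix hypersurface $\{v\in T_pM: F(v)=1\}$, with the Riemannian metric induced by $g_{ij}$, has positive sectional curvature (at all of its points and for all of its tangent planes). If the Finsler metrics $\tilde F=e^{\alpha}F$ and $F$ have the same mixed curvature tensor, $$\tilde P^l_{ijk}=P^l_{ijk}\qquad\text{at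 all non-zero tangent vectors of } M,$$ then $F$ is locally Riemannian at $p$: there are an open neighbourhood $U$ of $p$ and a smooth Riemannian metric $\gamma$ on $U$ such that $F(v)=\sqrt{\gamma(v,v)}$ for all $v\in TU$. -/

import Mathlib

open scoped Manifold ContDiff

noncomputable section

namespace Finsler

/-- The model space `ℝᵐ`. -/
abbrev Vec (m : ℕ) : Type := EuclideanSpace ℝ (Fin m)

/-- The `i`-th partial derivative of a real function on `ℝᵐ`. -/
def pd {m : ℕ} (i : Fin m) (f : Vec m → ℝ) (x : Vec m) : ℝ :=
  fderiv ℝ f x (EuclideanSpace.single i 1)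

/-! ### Sectional curvature of a Riemannian metric given in coordinates -/

section Riemann

variable {m : ℕ}

/-- Christoffel symbols `Γᶜ_{ab}` of the Levi-Civita connection of the metric `h_{ab}`. -/
def christoffel (h : Vec m → Matrix (Fin m) (Fin m) ℝ) (c a b : Fin m) (u : Vec m) : ℝ :=
  (1 / 2) * ∑ d, (h u)⁻¹ c d *
    (pd a (fun z => h z b d) u + pd b (fun z => h z a d) u - pd d (fun z => h z a b) u)

/-- Components of the curvature tensor, `R(∂_a, ∂_b) ∂_c = ∑ d, riemann h d c a b • ∂_d`. -/
def riemann (h : Vec m → Matrix (Fin m) (Fin m) ℝ) (d c a b : Fin m) (u : Vec m) : ℝ :=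
  pd a (christoffel h d b c) u - pd b (christoffel h d a c) u
    + ∑ e, (christoffel h d a e u * christoffel h e b c u
        - christoffel h d b e u * christoffel h e a c u)

/-- The scalar product `h_u(X, Y)`. -/
def metricInner (h : Vec m → Matrix (Fin m) (Fin m) ℝ) (u X Y : Vec m) : ℝ :=
  ∑ a, ∑ b, h u a b * X a * Y b

/-- The sectional curvature of the plane spanned by `X` and `Y`, that is
`⟨R(X,Y)Y, X⟩ / (⟨X,X⟩⟨Y,Y⟩ - ⟨X,Y⟩²)`. -/
def sectionalCurvature (h : Vec m → Matrix (Fin m) (Fin m) ℝ) (u X Y : Vec m) : ℝ :=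
  (∑ a, ∑ b, ∑ c, ∑ d, ∑ e, X a * Y b * Y c * riemann h d c a b u * h u d e * X e) /
    (metricInner h u X X * metricInner h u Y Y - metricInner h u X Y ^ 2)

end Riemann

/-! ### Finsler metrics -/

section Metric

variable {n : ℕ} {M : Type*} [TopologicalSpace M] [ChartedSpace (Vec n) M]

/-- The restriction to the tangent space at `q` of the energy `E = F² / 2`
(`TangentSpace (𝓡 n) q` is by definition the vector space `ℝⁿ`). -/
def energyAt (F : TangentBundle (𝓡 n) M → ℝ) (q : M) (v : Vec n) : ℝ :=
  (1 / 2) * F ⟨q, v⟩ ^ 2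

/-- The Riemann-Finsler metric `g_v(w, w')`: the Hessian at `v` of the energy on the tangent space
at `q`. -/
def fundamentalForm (F : TangentBundle (𝓡 n) M → ℝ) (q : M) (v w w' : Vec n) : ℝ :=
  fderiv ℝ (fun z => fderiv ℝ (energyAt F q) z w) v w'

/-- Finsler metric functions. -/
structure IsFinslerMetric [IsManifold (𝓡 n) ∞ M] (F : TangentBundle (𝓡 n) M → ℝ) : Prop where
  nonneg : ∀ v, 0 ≤ F v
  continuous : Continuous F
  smooth : ContMDiffOn (𝓡 n).tangent 𝓘(ℝ, ℝ) ∞ F {v | v.2 ≠ 0}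
  homogeneous : ∀ (q : M) (v : TangentSpace (𝓡 n) q) (t : ℝ), 0 < t → F ⟨q, t • v⟩ = t * F ⟨q, v⟩
  stronglyConvex : ∀ (q : M) (v : Vec n), v ≠ 0 →
    ∀ w : Vec n, w ≠ 0 → 0 < fundamentalForm F q v w w

/-- The conformal change `e^α F`. -/
def conformalChange (α : M → ℝ) (F : TangentBundle (𝓡 n) M → ℝ) (v : TangentBundle (𝓡 n) M) : ℝ :=
  Real.exp (α v.proj) * F v

/-! ### The mixed curvature of the Berwald connection in local coordinates -/

/-- The energy in the coordinates `(x, y)` of the tangent bundle that are induced by the chart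
`c`: here `y` stands for the tangent vector `∑ i, yⁱ ∂/∂uⁱ` at the point with coordinates `x`. -/
def coordEnergy (F : TangentBundle (𝓡 n) M → ℝ) (c : OpenPartialHomeomorph M (Vec n))
    (x y : Vec n) : ℝ :=
  (1 / 2) * F ⟨c.symm x, mfderiv (𝓡 n) (𝓡 n) c.symm x y⟩ ^ 2

/-- `g_{ij} = ∂²E / ∂yⁱ∂yʲ`. -/
def gCoord (E : Vec n → Vec n → ℝ) (x y : Vec n) : Matrix (Fin n) (Fin n) ℝ :=
  Matrix.of fun i j => pd j (pd i (E x)) y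

/-- Geodesic spray coefficients
`Gˡ = ½ gˡᵐ (yᵏ ∂²E / ∂yᵐ∂xᵏ - ∂E / ∂xᵐ)`. -/
def spray (E : Vec n → Vec n → ℝ) (l : Fin n) (x y : Vec n) : ℝ :=
  (1 / 2) * ∑ m, (gCoord E x y)⁻¹ l m *
    ((∑ k, y k * pd m (fun y' => pd k (fun x' => E x' y') x) y) - pd m (fun x' => E x' y) x)

/-- The mixed curvature `Pˡ_{ijk} = - ∂³Gˡ / ∂yⁱ∂yʲ∂yᵏ` of the Berwald connection. -/
def mixedCurvature (E : Vec n → Vec n → ℝ) (l i j k : Fin n) (x y : Vec n) : ℝ :=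
  - pd k (pd j (pd i (spray E l x))) y

/-- The mixed curvature tensors of the Berwald connections of `F₁` and `F₂` coincide: in every
local coordinate system they have the same components at all non-zero tangent vectors. -/
def SameMixedCurvature (F₁ F₂ : TangentBundle (𝓡 n) M → ℝ) : Prop :=
  ∀ c ∈ IsManifold.maximalAtlas (𝓡 n) ∞ M, ∀ x ∈ c.target, ∀ y : Vec n, y ≠ 0 →
    ∀ l i j k : Fin n,
      mixedCurvature (coordEnergy F₁ c) l i j k x y = mixedCurvature (coordEnergy F₂ c) l i j k x y

/-! ### The indicatrix -/

/-- `φ`, on the open set `W ⊆ ℝⁿ⁻¹`, is a smooth regular local parametrization of the indicatrix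
hypersurface `{v | F v = 1}` in the tangent space at `q`. -/
structure IsIndicatrixParam (F : TangentBundle (𝓡 n) M → ℝ) (q : M)
    (W : Set (Vec (n - 1))) (φ : Vec (n - 1) → Vec n) : Prop where
  isOpen : IsOpen W
  smooth : ContDiffOn ℝ ∞ φ W
  mem : ∀ u ∈ W, F ⟨q, φ u⟩ = 1
  immersion : ∀ u ∈ W, Function.Injective (fderiv ℝ φ u)

/-- The Riemannian metric induced on the indicatrix by the Riemann-Finsler metric, in the
parametrization `φ`: `h_{ab}(u) = g_{φ(u)}(∂_a φ, ∂_b φ)`. -/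
def inducedMetric (F : TangentBundle (𝓡 n) M → ℝ) (q : M) (φ : Vec (n - 1) → Vec n)
    (u : Vec (n - 1)) : Matrix (Fin (n - 1)) (Fin (n - 1)) ℝ :=
  Matrix.of fun a b => fundamentalForm F q (φ u)
    (fderiv ℝ φ u (EuclideanSpace.single a 1)) (fderiv ℝ φ u (EuclideanSpace.single b 1))

/-- The sectional curvature of the indicatrix hypersurface at `q` (all of its points and all
planes tangent to it) is positive. -/
def PositivelyCurvedIndicatrix (F : TangentBundle (𝓡 n) M → ℝ) (q : M) : Prop :=
  ∀ (W : Set (Vec (n - 1))) (φ : Vec (n - 1) → Vec n), IsIndicatrixParam F q W φ →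
    ∀ u ∈ W, ∀ X Y : Vec (n - 1), LinearIndependent ℝ ![X, Y] →
      0 < sectionalCurvature (inducedMetric F q φ) u X Y

/-! ### Riemannian metric functions -/

/-- `F` is Riemannian on the open set `U`: there `F v = √(γ(v, v))` for a smooth Riemannian
metric `γ`. -/
def IsRiemannianOn [IsManifold (𝓡 n) ∞ M] (F : TangentBundle (𝓡 n) M → ℝ) (U : Set M) : Prop :=
  ∃ γ : (q : M) → TangentSpace (𝓡 n) q →L[ℝ] TangentSpace (𝓡 n) q →L[ℝ] ℝ,
    ContMDiffOn (𝓡 n) ((𝓡 n).prod 𝓘(ℝ, Vec n →L[ℝ] Vec n →L[ℝ] ℝ)) ∞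
      (fun q => Bundle.TotalSpace.mk' (Vec n →L[ℝ] Vec n →L[ℝ] ℝ)
        (E := fun q : M => TangentSpace (𝓡 n) q →L[ℝ] TangentSpace (𝓡 n) q →L[ℝ] ℝ) q (γ q)) U ∧
    ∀ q ∈ U, (∀ v w, γ q v w = γ q w v) ∧ (∀ v, v ≠ 0 → 0 < γ q v v) ∧
      ∀ v, F ⟨q, v⟩ = Real.sqrt (γ q v v)

end Metric

end Finsler

end

/-! Multiplying `F` by e^β subtracts from the geodesic spray the vector field E grad β − dβ(y) y,
the gradient being taken for g_y (`spray_conformal`). Equal mixed curvatures force the third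
y-derivatives of this field to vanish; being homogeneous of degree two, it is quadratic in y. With a
= dβ this yields a symmetric bilinear B with g_y(w, B(y,y)) = 2E(y) a(w), a condition on a single
tangent space (`HasQuadraticGradient`).

Differentiating it gives dE_y(B(y,w)) = a(y) dE_y(w). Let y₀ maximise a²/E. There a is proportional
to dE, so for g₀, the Hessian of E at y₀, the line ℝy₀ is orthogonal to ker a, and B(y₀,w) = a(w)
y₀. For h in ker a, the compression of B(h,·) to ker a is g₀-symmetric. The identity along the line
h + s y₀, combined with strict convexity of E on that line, shows that only one eigenvalue is
visible from h, so B(h,h) lies in the span of h and y₀ (`exists_apply_self_eq`). As ker a has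
dimension at least two, comparing orthogonal directions removes the h-component (`apply_self_eq`).
Substituting back makes dE_y proportional to g₀(y,·), and E is then a constant multiple of g₀(y,y)
(`exists_eq_const_mul`).

The derivative of α is non-zero on a whole neighbourhood of p, so this applies at every point there;
polarization of E shows that the quadratic forms vary smoothly. -/

namespace Finsler

/-! ### Homogeneous functions and Minkowski energies on one vector space -/

section Minkowski

variable {V : Type*} [NormedAddCommGroup V] [NormedSpace ℝ V]

/-- Two functions that agree away from the origin have the same derivatives there. -/
theorem fderiv_unique_of_eqOn {W : Type*} [NormedAddCommGroup W] [NormedSpace ℝ W]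
    {y : V} {f g : V → W} {f' g' : V →L[ℝ] W} (hy : y ≠ 0) (hf : HasFDerivAt f f' y)
    (hg : HasFDerivAt g g' y) (h : ∀ z, z ≠ 0 → f z = g z) (w : V) : f' w = g' w := by
  have : f =ᶠ[nhds y] g := by
    filter_upwards [isOpen_compl_singleton.mem_nhds hy] with z hz using h z hz
  rw [(hg.congr_of_eventuallyEq this).unique hf]

section Homogeneous

variable {f : V → ℝ} {y : V}

theorem fderiv_apply_self_of_homogeneous (hf : ContDiffOn ℝ ∞ f {0}ᶜ)
    (hhom : ∀ (t : ℝ) (y : V), 0 < t → f (t • y) = t ^ 2 * f y)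
    (hy : y ≠ 0) : fderiv ℝ f y y = 2 * f y := by
  have hd : DifferentiableAt ℝ f y :=
    (hf.contDiffAt (isOpen_compl_singleton.mem_nhds hy)).differentiableAt (by simp)
  have h1 : HasDerivAt (fun t : ℝ => f (t • y)) (fderiv ℝ f y y) 1 := by
    have hy' : HasFDerivAt f (fderiv ℝ f y) ((1 : ℝ) • y) := by
      rw [one_smul]; exact hd.hasFDerivAt
    have := hy'.comp_hasDerivAt (1 : ℝ) ((hasDerivAt_id (1 : ℝ)).smul_const y)
    simpa [Function.comp_def] using this
  have h2 : HasDerivAt (fun t : ℝ => t ^ 2 * f y) (2 * f y) 1 := by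
    simpa using (hasDerivAt_pow 2 (1 : ℝ)).mul_const (f y)
  refine h1.unique (h2.congr_of_eventuallyEq ?_)
  filter_upwards [lt_mem_nhds (zero_lt_one (α := ℝ))] with t ht
  exact hhom t y ht

theorem hessian_apply_self_of_homogeneous (hf : ContDiffOn ℝ ∞ f {0}ᶜ)
    (hhom : ∀ (t : ℝ) (y : V), 0 < t → f (t • y) = t ^ 2 * f y) (hy : y ≠ 0) (w : V) :
    fderiv ℝ (fderiv ℝ f) y w y = fderiv ℝ f y w := by
  have hc := hf.contDiffAt (isOpen_compl_singleton.mem_nhds hy)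
  have h1 := (((hc.fderiv_right (m := ∞) (by simp)).differentiableAt
    (by simp)).hasFDerivAt).clm_apply (hasFDerivAt_id y)
  have h2 := ((hc.differentiableAt (by simp)).hasFDerivAt).const_mul 2
  have := fderiv_unique_of_eqOn hy h1 h2
    (fun z hz => by simpa using fderiv_apply_self_of_homogeneous hf hhom hz) w
  simp at this
  linarith

end Homogeneous

/-- `E` is the energy of a Minkowski norm: smooth away from the origin, positively homogeneous of
degree two, with positive definite Hessian. -/
structure IsMinkowskiEnergy (E : V → ℝ) : Prop where
  smooth : ContDiffOn ℝ ∞ E {0}ᶜ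
  homogeneous : ∀ (t : ℝ) (y : V), 0 < t → E (t • y) = t ^ 2 * E y
  posDef : ∀ y : V, y ≠ 0 → ∀ w : V, w ≠ 0 → 0 < fderiv ℝ (fderiv ℝ E) y w w

namespace IsMinkowskiEnergy

variable {E : V → ℝ} {y : V}

theorem contDiffAt (hE : IsMinkowskiEnergy E) (hy : y ≠ 0) : ContDiffAt ℝ ∞ E y :=
  hE.smooth.contDiffAt (isOpen_compl_singleton.mem_nhds hy)

theorem contDiffAt_fderiv (hE : IsMinkowskiEnergy E) (hy : y ≠ 0) :
    ContDiffAt ℝ ∞ (fderiv ℝ E) y :=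
  (hE.contDiffAt hy).fderiv_right (by simp)

theorem contDiffAt_fderiv_fderiv (hE : IsMinkowskiEnergy E) (hy : y ≠ 0) :
    ContDiffAt ℝ ∞ (fderiv ℝ (fderiv ℝ E)) y :=
  (hE.contDiffAt_fderiv hy).fderiv_right (by simp)

theorem hasFDerivAt (hE : IsMinkowskiEnergy E) (hy : y ≠ 0) :
    HasFDerivAt E (fderiv ℝ E y) y :=
  ((hE.contDiffAt hy).differentiableAt (by simp)).hasFDerivAt

theorem hasFDerivAt_fderiv (hE : IsMinkowskiEnergy E) (hy : y ≠ 0) :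
    HasFDerivAt (fderiv ℝ E) (fderiv ℝ (fderiv ℝ E) y) y :=
  ((hE.contDiffAt_fderiv hy).differentiableAt (by simp)).hasFDerivAt

theorem hasFDerivAt_fderiv_fderiv (hE : IsMinkowskiEnergy E) (hy : y ≠ 0) :
    HasFDerivAt (fderiv ℝ (fderiv ℝ E)) (fderiv ℝ (fderiv ℝ (fderiv ℝ E)) y) y :=
  ((hE.contDiffAt_fderiv_fderiv hy).differentiableAt (by simp)).hasFDerivAt

theorem hessian_symm (hE : IsMinkowskiEnergy E) (hy : y ≠ 0) (u w : V) :
    fderiv ℝ (fderiv ℝ E) y u w = fderiv ℝ (fderiv ℝ E) y w u :=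
  ((hE.contDiffAt hy).isSymmSndFDerivAt (by simpa using ENat.LEInfty.out)) u w

theorem fderiv_apply_self (hE : IsMinkowskiEnergy E) (hy : y ≠ 0) :
    fderiv ℝ E y y = 2 * E y :=
  fderiv_apply_self_of_homogeneous hE.smooth hE.homogeneous hy

theorem hessian_apply_self (hE : IsMinkowskiEnergy E) (hy : y ≠ 0) (w : V) :
    fderiv ℝ (fderiv ℝ E) y w y = fderiv ℝ E y w :=
  hessian_apply_self_of_homogeneous hE.smooth hE.homogeneous hy w

theorem pos (hE : IsMinkowskiEnergy E) (hy : y ≠ 0) : 0 < E y := by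
  have h1 := hE.posDef y hy y hy
  rw [hE.hessian_apply_self hy, hE.fderiv_apply_self hy] at h1
  linarith

/-- Differentiate g_z(u,z) = dE_z(u) in z: the two Hessian terms cancel by symmetry. This is the
vanishing of the Cartan tensor on its base vector. -/
theorem thirdDeriv_apply_self (hE : IsMinkowskiEnergy E) (hy : y ≠ 0) (w u : V) :
    fderiv ℝ (fderiv ℝ (fderiv ℝ E)) y w u y = 0 := by
  have h1 := ((hE.hasFDerivAt_fderiv_fderiv hy).clm_apply (hasFDerivAt_const u y)).clm_apply
    (hasFDerivAt_id y)
  have h2 := (hE.hasFDerivAt_fderiv hy).clm_apply (hasFDerivAt_const u y)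
  have := fderiv_unique_of_eqOn hy h1 h2 (fun z hz => by simpa using hE.hessian_apply_self hz u) w
  simp at this
  have h3 := hE.hessian_symm hy u w
  linarith

/-- A non-zero linear form is proportional to the derivative of the energy at some vector. -/
theorem exists_linearForm_eq_fderiv [FiniteDimensional ℝ V] (hE : IsMinkowskiEnergy E)
    {a : V →L[ℝ] ℝ} (ha : a ≠ 0) :
    ∃ y : V, a y ≠ 0 ∧ ∀ w, 2 * E y * a w = a y * fderiv ℝ E y w := by
  obtain ⟨v, hv⟩ : ∃ v, a v ≠ 0 := by
    by_contra! h
    exact ha (ContinuousLinearMap.ext h)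
  have hv0 : v ≠ 0 := fun h => hv (by simp [h])
  have hnt : Nontrivial V := ⟨v, 0, hv0⟩
  -- This quotient is homogeneous of degree zero, so its maximum on the unit sphere is global; the
  -- maximiser is the required vector.
  let f : V → ℝ := fun y => a y ^ 2 / E y
  have hfh : ∀ (t : ℝ) (y : V), 0 < t → f (t • y) = f y := by
    intro t y ht
    simp only [f, map_smul, smul_eq_mul, hE.homogeneous t y ht]
    rw [mul_pow, mul_div_mul_left _ _ (by positivity)]
  have hcont : ContinuousOn f (Metric.sphere (0 : V) 1) := by
    intro z hz
    have hz0 : z ≠ 0 := by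
      rintro rfl; simp at hz
    exact (((a.continuous.pow 2).continuousAt).div (hE.contDiffAt hz0).continuousAt
      (hE.pos hz0).ne').continuousWithinAt
  obtain ⟨y, hy1, hmax⟩ := (isCompact_sphere (0 : V) 1).exists_isMaxOn
    (NormedSpace.sphere_nonempty.2 zero_le_one) hcont
  have hy0 : y ≠ 0 := by
    rintro rfl; simp at hy1
  have hglob : ∀ z, z ≠ 0 → f z ≤ f y := by
    intro z hz
    have hn : 0 < ‖z‖ := norm_pos_iff.2 hz
    rw [← hfh ‖z‖⁻¹ z (inv_pos.2 hn)]
    apply hmax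
    simp [norm_smul, hn.ne']
  have hay : a y ≠ 0 := by
    intro h
    have h1 := hglob v hv0
    have h2 : 0 < f v := div_pos (by positivity) (hE.pos hv0)
    simp only [f, h] at h1 h2
    norm_num at h1
    linarith
  refine ⟨y, hay, fun w => ?_⟩
  have hEy := hE.pos hy0
  have hfy : f y * E y = a y ^ 2 := div_mul_cancel₀ _ hEy.ne'
  -- Clearing the denominator turns the maximum of a²/E into a minimum, with value 0, of a function
  -- that is easier to differentiate.
  have hloc : IsLocalMin (fun z => f y * E z - a z ^ 2) y := by
    filter_upwards [isOpen_compl_singleton.mem_nhds hy0] with z hz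
    have := (div_le_iff₀ (hE.pos hz)).1 (hglob z hz)
    linarith
  have hd := ((hE.hasFDerivAt hy0).const_mul (f y)).sub (a.hasFDerivAt.pow 2)
  have h0 := congrArg (fun φ : V →L[ℝ] ℝ => φ w) (hloc.hasFDerivAt_eq_zero hd)
  simp at h0
  apply mul_left_cancel₀ hay
  linear_combination -E y * h0 + fderiv ℝ E y w * hfy

end IsMinkowskiEnergy

end Minkowski

/-! ### A spectral lemma and a continuity lemma -/

/-- If all eigenvalues of a symmetric operator that are visible from `h` coincide, then `h` is an
eigenvector. -/
theorem exists_apply_eq_smul_of_symmetric {V : Type*} [AddCommGroup V] [Module ℝ V]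
    [FiniteDimensional ℝ V] (γ : V →ₗ[ℝ] V →ₗ[ℝ] ℝ) (hsymm : ∀ u w, γ u w = γ w u)
    (hpos : ∀ w, w ≠ 0 → 0 < γ w w) (T : V →ₗ[ℝ] V) (hT : ∀ u w, γ (T u) w = γ u (T w)) (h : V)
    (heq : ∀ (l m : ℝ) (e f : V), T e = l • e → T f = m • f → γ h e ≠ 0 → γ h f ≠ 0 → l = m) :
    ∃ l : ℝ, T h = l • h := by
  -- Taking γ as the inner product makes the spectral theorem available for `T`.
  let core : InnerProductSpace.Core ℝ V :=
    { inner := fun u w => γ u w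
      conj_inner_symm := fun u w => by simpa using hsymm w u
      re_inner_nonneg := fun w => by
        rcases eq_or_ne w 0 with rfl | hw
        · simp
        · simpa using (hpos w hw).le
      add_left := fun u w z => by simp
      smul_left := fun u w r => by simp
      definite := fun w hw => by
        by_contra hne
        exact (hpos w hne).ne' hw }
  let _ : NormedAddCommGroup V := @InnerProductSpace.Core.toNormedAddCommGroup ℝ V _ _ _ core
  let _ : InnerProductSpace ℝ V := InnerProductSpace.ofCore core.toCore
  have hin : ∀ u w : V, inner ℝ u w = γ u w := fun u w => rfl
  have hS : T.IsSymmetric := fun u w => hT u w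
  let b := hS.eigenvectorBasis rfl
  have hb : ∀ i, T (b i) = hS.eigenvalues rfl i • b i := fun i =>
    hS.apply_eigenvectorBasis rfl i
  by_cases hall : ∀ i, γ h (b i) = 0
  · refine ⟨0, ?_⟩
    have : h = 0 := InnerProductSpace.ext_inner_right_basis b.toBasis fun i => by
      simpa [hin] using hall i
    simp [this]
  · push Not at hall
    obtain ⟨i, hi⟩ := hall
    refine ⟨hS.eigenvalues rfl i, InnerProductSpace.ext_inner_right_basis b.toBasis fun j => ?_⟩
    simp only [OrthonormalBasis.coe_toBasis, hin]
    rw [hT, hb, map_smul, map_smul, LinearMap.smul_apply]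
    by_cases hj : γ h (b j) = 0
    · simp [hj]
    · rw [heq _ _ _ _ (hb j) (hb i) hj hi]

theorem eq_of_forall_ne_zero_eq {f g : ℝ → ℝ} (hf : ContinuousAt f 0) (hg : ContinuousAt g 0)
    (h : ∀ t, t ≠ 0 → f t = g t) : f 0 = g 0 := by
  refine tendsto_nhds_unique (hf.tendsto.mono_left (nhdsWithin_le_nhds (s := {0}ᶜ)))
    ((hg.tendsto.mono_left (nhdsWithin_le_nhds (s := {0}ᶜ))).congr' ?_)
  filter_upwards [self_mem_nhdsWithin] with t ht using (h t ht).symm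

/-! ### First consequences of the quadratic gradient condition -/

section QuadraticGradient

variable {V : Type*} [NormedAddCommGroup V] [NormedSpace ℝ V] {E : V → ℝ} {a : V →L[ℝ] ℝ}
  {B : V →L[ℝ] V →L[ℝ] V} {y y₀ : V}

/-- The derivative in s is the Hessian on (v,v), which is positive: E is strictly convex along a
line that misses the origin. -/
theorem IsMinkowskiEnergy.fderiv_line_injective (hE : IsMinkowskiEnergy E) {h v : V} (hv : v ≠ 0)
    (hne : ∀ s : ℝ, h + s • v ≠ 0) :
    Function.Injective fun s : ℝ => fderiv ℝ E (h + s • v) v := by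
  refine (strictMono_of_hasDerivAt_pos
    (f' := fun s => fderiv ℝ (fderiv ℝ E) (h + s • v) v v) (fun s => ?_)
    fun s => hE.posDef _ (hne s) v hv).injective
  have h1 : HasDerivAt (fun s : ℝ => h + s • v) v s := by
    simpa using ((hasDerivAt_id s).smul_const v).const_add h
  have h2 := (hE.hasFDerivAt_fderiv (hne s)).comp_hasDerivAt s h1
  simpa [Function.comp_def] using h2.clm_apply (hasDerivAt_const s v)

/-- The vector field `y ↦ ½ B(y, y)` is the Hessian gradient of the linear form `a` multiplied by
the energy `E`. -/
structure HasQuadraticGradient (E : V → ℝ) (a : V →L[ℝ] ℝ) (B : V →L[ℝ] V →L[ℝ] V) : Prop where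
  symm : ∀ u w, B u w = B w u
  hessian_apply : ∀ y, y ≠ 0 → ∀ w, fderiv ℝ (fderiv ℝ E) y w (B y y) = 2 * E y * a w

namespace HasQuadraticGradient

theorem hasFDerivAt_diag (B : V →L[ℝ] V →L[ℝ] V) (y : V) :
    HasFDerivAt (fun y => B y y) (B y + B.flip y) y := by
  have := B.hasFDerivAt.clm_apply (hasFDerivAt_id y)
  simpa using this

/-- Taking w = y in `hessian_apply` gives dE_y(B(y,y)) = 2E(y) a(y). In the derivative of this, the
terms g_y(w, B(y,y)) and 2E(y) a(w) cancel, again by `hessian_apply`. -/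
theorem fderiv_apply (hB : HasQuadraticGradient E a B) (hE : IsMinkowskiEnergy E) (hy : y ≠ 0)
    (w : V) : fderiv ℝ E y (B y w) = a y * fderiv ℝ E y w := by
  have h1 := (hE.hasFDerivAt_fderiv hy).clm_apply (hasFDerivAt_diag B y)
  have h2 := ((hE.hasFDerivAt hy).const_mul 2).mul a.hasFDerivAt
  have := fderiv_unique_of_eqOn hy h1 h2 (fun z hz => by
    rw [← hE.hessian_apply_self hz, hE.hessian_symm hz, hB.hessian_apply z hz]; rfl) w
  simp [hB.hessian_apply y hy, hB.symm w y] at this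
  linarith

/-- This is `fderiv_apply` differentiated in y along z, with w fixed. -/
theorem fderiv_apply_deriv (hB : HasQuadraticGradient E a B) (hE : IsMinkowskiEnergy E)
    (hy : y ≠ 0) (z w : V) :
    fderiv ℝ (fderiv ℝ E) y z (B y w) + fderiv ℝ E y (B z w) =
      a z * fderiv ℝ E y w + a y * fderiv ℝ (fderiv ℝ E) y z w := by
  have h1 := (hE.hasFDerivAt_fderiv hy).clm_apply (B.hasFDerivAt.clm_apply (hasFDerivAt_const w y))
  have h2 := a.hasFDerivAt.mul ((hE.hasFDerivAt_fderiv hy).clm_apply (hasFDerivAt_const w y))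
  have := fderiv_unique_of_eqOn hy h1 h2 (fun u hu => hB.fderiv_apply hE hu w) z
  simp at this
  linarith

/-- At y₀ the form a is a multiple of dE, so B(y₀,y₀) = a(y₀) y₀. Hence differentiating
`hessian_apply` at y₀ produces no third-derivative term, and what remains determines B(y₀,w) because
the Hessian is nondegenerate. -/
theorem apply_crit (hB : HasQuadraticGradient E a B) (hE : IsMinkowskiEnergy E) (ha₀ : a y₀ ≠ 0)
    (hcrit : ∀ w, 2 * E y₀ * a w = a y₀ * fderiv ℝ E y₀ w) (w : V) : B y₀ w = a w • y₀ := by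
  have hy : y₀ ≠ 0 := fun h => ha₀ (by simp [h])
  have nondeg : ∀ u v, (∀ z, fderiv ℝ (fderiv ℝ E) y₀ z u = fderiv ℝ (fderiv ℝ E) y₀ z v) →
      u = v := by
    intro u v huv
    by_contra hne
    have h1 := hE.posDef y₀ hy (u - v) (sub_ne_zero.2 hne)
    rw [map_sub, huv] at h1
    simp at h1
  have hself : B y₀ y₀ = a y₀ • y₀ := nondeg _ _ fun z => by
    rw [hB.hessian_apply y₀ hy, map_smul, hE.hessian_apply_self hy, smul_eq_mul, hcrit]
  refine nondeg _ _ fun u => ?_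
  have h1 := ((hE.hasFDerivAt_fderiv_fderiv hy).clm_apply (hasFDerivAt_const u y₀)).clm_apply
    (hasFDerivAt_diag B y₀)
  have h2 := ((hE.hasFDerivAt hy).const_mul 2).mul_const (a u)
  have := fderiv_unique_of_eqOn hy h1 h2 (fun z hz => hB.hessian_apply z hz u) w
  simp [hself, hE.thirdDeriv_apply_self hy, hB.symm w y₀] at this
  rw [map_smul, hE.hessian_apply_self hy, smul_eq_mul]
  apply mul_left_cancel₀ ha₀
  linear_combination a y₀ * this / 2 - a u * hcrit w + a w * hcrit u

/-- In `fderiv_apply_deriv` at y₀, `apply_crit` turns the first term into a(w) dE(z), which equals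
a(z) dE(w) because a and dE are proportional there. What is left is dE(B(z,w)) = a(y₀) g₀(z,w). -/
theorem linearForm_apply (hB : HasQuadraticGradient E a B) (hE : IsMinkowskiEnergy E)
    (ha₀ : a y₀ ≠ 0) (hcrit : ∀ w, 2 * E y₀ * a w = a y₀ * fderiv ℝ E y₀ w) (z w : V) :
    2 * E y₀ * a (B z w) = a y₀ ^ 2 * fderiv ℝ (fderiv ℝ E) y₀ z w := by
  have hy : y₀ ≠ 0 := fun h => ha₀ (by simp [h])
  have h1 := hB.fderiv_apply_deriv hE hy z w
  rw [hB.apply_crit hE ha₀ hcrit, map_smul, hE.hessian_apply_self hy, smul_eq_mul] at h1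
  linear_combination hcrit (B z w) + a y₀ * h1 - a z * hcrit w + a w * hcrit z

theorem hessian_crit_of_mem_ker (hE : IsMinkowskiEnergy E) (ha₀ : a y₀ ≠ 0)
    (hcrit : ∀ w, 2 * E y₀ * a w = a y₀ * fderiv ℝ E y₀ w) {w : V} (hw : a w = 0) :
    fderiv ℝ (fderiv ℝ E) y₀ w y₀ = 0 := by
  have hy : y₀ ≠ 0 := fun h => ha₀ (by simp [h])
  rw [hE.hessian_apply_self hy]
  have := hcrit w
  rw [hw, mul_zero] at this
  exact (mul_eq_zero.1 this.symm).resolve_left ha₀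

theorem add_smul_crit_ne_zero (ha₀ : a y₀ ≠ 0) {h : V} (hh : a h = 0) (hne : h ≠ 0) (s : ℝ) :
    h + s • y₀ ≠ 0 := by
  intro h0
  have h1 := congrArg a h0
  simp [hh, ha₀] at h1
  rw [h1] at h0
  simp [hne] at h0

/-- For z, w in ker a, `fderiv_apply_deriv` shows that g_u(z, B(u,w)) is symmetric in z and w at
every u ≠ 0. At u = y₀ + t h one has B(u,w) = t B(h,w), so t can be divided out before letting t
tend to 0. -/
theorem hessian_crit_symm (hB : HasQuadraticGradient E a B) (hE : IsMinkowskiEnergy E)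
    (ha₀ : a y₀ ≠ 0) (hcrit : ∀ w, 2 * E y₀ * a w = a y₀ * fderiv ℝ E y₀ w)
    {h z w : V} (hz : a z = 0) (hw : a w = 0) :
    fderiv ℝ (fderiv ℝ E) y₀ z (B h w) = fderiv ℝ (fderiv ℝ E) y₀ w (B h z) := by
  have hy : y₀ ≠ 0 := fun h => ha₀ (by simp [h])
  have key : ∀ u : V, u ≠ 0 →
      fderiv ℝ (fderiv ℝ E) u z (B u w) = fderiv ℝ (fderiv ℝ E) u w (B u z) := by
    intro u hu
    have h1 := hB.fderiv_apply_deriv hE hu z w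
    have h2 := hB.fderiv_apply_deriv hE hu w z
    rw [hB.symm w z, hE.hessian_symm hu w z] at h2
    rw [hz] at h1
    rw [hw] at h2
    linarith
  have hline : ContinuousAt (fun t : ℝ => y₀ + t • h) 0 := by fun_prop
  have hg : ContinuousAt (fderiv ℝ (fderiv ℝ E)) (y₀ + (0 : ℝ) • h) := by
    simpa using (hE.contDiffAt_fderiv_fderiv hy).continuousAt
  have hgl : ContinuousAt (fun t : ℝ => fderiv ℝ (fderiv ℝ E) (y₀ + t • h)) 0 :=
    ContinuousAt.comp (f := fun t : ℝ => y₀ + t • h) hg hline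
  have hev : ∀ᶠ t : ℝ in nhds 0, y₀ + t • h ≠ 0 :=
    hline.eventually_ne (by simpa using hy)
  have hlim : ∀ u v : V, Filter.Tendsto
      (fun t : ℝ => fderiv ℝ (fderiv ℝ E) (y₀ + t • h) u v) (nhdsWithin 0 {0}ᶜ)
      (nhds (fderiv ℝ (fderiv ℝ E) y₀ u v)) := fun u v => by
    have : ContinuousAt (fun t : ℝ => fderiv ℝ (fderiv ℝ E) (y₀ + t • h) u v) 0 :=
      (hgl.clm_apply continuousAt_const).clm_apply continuousAt_const
    simpa using this.tendsto.mono_left nhdsWithin_le_nhds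
  refine tendsto_nhds_unique (hlim z (B h w)) ((hlim w (B h z)).congr' ?_)
  filter_upwards [self_mem_nhdsWithin, hev.filter_mono nhdsWithin_le_nhds] with t ht hne
  have := key _ hne
  simp only [map_add, map_smul, add_apply, smul_apply,
    hB.apply_crit hE ha₀ hcrit, hz, hw, zero_smul, zero_add, smul_eq_mul] at this
  exact (mul_left_cancel₀ ht this).symm

end HasQuadraticGradient

end QuadraticGradient

/-! ### Rigidity: the energy is a quadratic form -/

namespace HasQuadraticGradient

variable {V : Type*} [NormedAddCommGroup V] [NormedSpace ℝ V] {E : V → ℝ} {a : V →L[ℝ] ℝ}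
  {B : V →L[ℝ] V →L[ℝ] V} {y₀ : V}

/-- An eigenvalue l of the compression of B(h,·) whose eigenvector is not g₀-orthogonal to h forces
dE(y₀) = 0 at the point h + (l / a(y₀)) y₀. By strict convexity this happens at most once on the
line, so all such eigenvalues agree and h is itself an eigenvector. -/
theorem exists_apply_self_eq (hB : HasQuadraticGradient E a B) (hE : IsMinkowskiEnergy E)
    (ha₀ : a y₀ ≠ 0) (hcrit : ∀ w, 2 * E y₀ * a w = a y₀ * fderiv ℝ E y₀ w)
    [FiniteDimensional ℝ V] {h : V} (hh : a h = 0) :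
    ∃ l c : ℝ, B h h = l • h + c • y₀ := by
  have hy : y₀ ≠ 0 := fun h => ha₀ (by simp [h])
  have hEy := hE.pos hy
  rcases eq_or_ne h 0 with rfl | hne
  · exact ⟨0, 0, by simp⟩
  -- Projection onto ker a along y₀; it is g₀-orthogonal.
  let π : V →ₗ[ℝ] V := LinearMap.id - (a.toLinearMap.smulRight ((a y₀)⁻¹ • y₀))
  have hπ : ∀ v, π v = v - a v • (a y₀)⁻¹ • y₀ := fun v => rfl
  have haπ : ∀ v, a (π v) = 0 := fun v => by
    rw [hπ, map_sub, map_smul, map_smul, smul_eq_mul, smul_eq_mul, inv_mul_cancel₀ ha₀, mul_one,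
      sub_self]
  have hBπ : ∀ v, B h (π v) = B h v := fun v => by
    rw [hπ, map_sub, map_smul, map_smul, hB.symm h y₀, hB.apply_crit hE ha₀ hcrit, hh]
    simp
  let g := fderiv ℝ (fderiv ℝ E) y₀
  have hgs : ∀ u w, g u w = g w u := hE.hessian_symm hy
  have hker : ∀ w, a w = 0 → g w y₀ = 0 := fun w hw => hessian_crit_of_mem_ker hE ha₀ hcrit hw
  have hgπ : ∀ u w, a u = 0 → g u (π w) = g u w := fun u w hu => by
    rw [hπ, map_sub, map_smul, map_smul, hker u hu]; simp
  have key : ∀ (l : ℝ) (e : V), π (B h e) = l • e → g h e ≠ 0 →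
      fderiv ℝ E (h + (l / a y₀) • y₀) y₀ = 0 := by
    intro l e he hge
    -- For l = 0 the eigenvector e may have a y₀-component, so it is replaced by π e; `B h` does not
    -- see the difference.
    have hw : B h (π e) = l • π e + (a (B h (π e)) * (a y₀)⁻¹) • y₀ := by
      have h1 := congrArg π he
      rw [map_smul, hπ (π (B h e)), haπ, zero_smul, sub_zero] at h1
      rw [← h1, hBπ, hπ, smul_smul, sub_add_cancel]
    -- The point is chosen so that a takes the value l there: the terms l dE(π e) on both sides
    -- cancel, leaving a multiple of dE(y₀).
    have h1 := hB.fderiv_apply hE (add_smul_crit_ne_zero ha₀ hh hne (l / a y₀)) (π e)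
    rw [map_add, map_smul, add_apply, smul_apply, hB.apply_crit hE ha₀ hcrit, haπ, zero_smul,
      smul_zero, add_zero, hw, map_add, map_smul, map_smul, map_add, map_smul, hh] at h1
    simp only [smul_eq_mul, zero_add, div_mul_cancel₀ l ha₀, add_eq_left] at h1
    have h2 := hB.linearForm_apply hE ha₀ hcrit h (π e)
    have h3 : g h (π e) ≠ 0 := by rwa [hgπ h e hh]
    have h4 : a (B h (π e)) ≠ 0 := by
      intro h0
      rw [h0, mul_zero] at h2
      exact mul_ne_zero (pow_ne_zero 2 ha₀) h3 h2.symm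
    exact (mul_eq_zero.1 h1).resolve_left (mul_ne_zero h4 (inv_ne_zero ha₀))
  obtain ⟨l, hl⟩ := exists_apply_eq_smul_of_symmetric
    (ContinuousLinearMap.coeLM ℝ ∘ₗ g.toLinearMap) hgs (fun w hw => hE.posDef y₀ hy w hw)
    (π ∘ₗ (B h).toLinearMap) (fun u w => by
      change g (π (B h u)) w = g u (π (B h w))
      rw [← hgπ _ w (haπ _), hgs, hgπ _ _ (haπ w), hgs u, ← hgπ _ u (haπ _), hgs _ (π u),
        hgπ _ _ (haπ u), ← hBπ u, ← hBπ w]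
      exact hB.hessian_crit_symm hE ha₀ hcrit (haπ w) (haπ u)) h
    (fun l m e f he hf hge hgf => by
      have := hE.fderiv_line_injective hy (add_smul_crit_ne_zero ha₀ hh hne)
        ((key l e he hge).trans (key m f hf hgf).symm)
      field_simp at this
      exact this)
  refine ⟨l, a (B h h) * (a y₀)⁻¹, ?_⟩
  have hl' : π (B h h) = l • h := hl
  rw [← hl', hπ, smul_smul, sub_add_cancel]

/-- In dimension three the kernels of a and of g₀(h,·) share a non-zero vector, which is rescaled to
the g₀-length of h. -/
theorem exists_orthogonal (hE : IsMinkowskiEnergy E) (ha₀ : a y₀ ≠ 0)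
    [FiniteDimensional ℝ V] (hdim : 3 ≤ Module.finrank ℝ V) {h : V} (hne : h ≠ 0) :
    ∃ f, a f = 0 ∧ fderiv ℝ (fderiv ℝ E) y₀ f h = 0 ∧
      fderiv ℝ (fderiv ℝ E) y₀ f f = fderiv ℝ (fderiv ℝ E) y₀ h h := by
  have hy : y₀ ≠ 0 := fun h => ha₀ (by simp [h])
  let φ : V →ₗ[ℝ] ℝ × ℝ := a.toLinearMap.prod (fderiv ℝ (fderiv ℝ E) y₀ h).toLinearMap
  have hker : LinearMap.ker φ ≠ ⊥ := by
    apply LinearMap.ker_ne_bot_of_finrank_lt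
    simp
    omega
  obtain ⟨f, hf, hf0⟩ := (Submodule.ne_bot_iff _).1 hker
  have hf' : a f = 0 ∧ fderiv ℝ (fderiv ℝ E) y₀ h f = 0 := by
    simpa [φ] using hf
  have hp := hE.posDef y₀ hy f hf0
  have hq := hE.posDef y₀ hy h hne
  refine ⟨√(fderiv ℝ (fderiv ℝ E) y₀ h h / fderiv ℝ (fderiv ℝ E) y₀ f f) • f, by simp [hf'.1],
    ?_, ?_⟩
  · rw [hE.hessian_symm hy, map_smul, hf'.2, smul_zero]
  · rw [map_smul, map_smul, smul_apply, smul_smul, Real.mul_self_sqrt (by positivity),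
      smul_eq_mul, div_mul_cancel₀ _ hp.ne']

/-- On ker a the trilinear form g₀(u, B(v,w)) is totally symmetric, and by `exists_apply_self_eq` it
vanishes on (f,e,e) whenever f ⊥ e. Polarizing over orthogonal pairs of equal length makes it vanish
on (e,e,e) too. -/
theorem apply_self_eq (hB : HasQuadraticGradient E a B) (hE : IsMinkowskiEnergy E)
    (ha₀ : a y₀ ≠ 0) (hcrit : ∀ w, 2 * E y₀ * a w = a y₀ * fderiv ℝ E y₀ w)
    [FiniteDimensional ℝ V] (hdim : 3 ≤ Module.finrank ℝ V)
    {h : V} (hh : a h = 0) : a y₀ • B h h = a (B h h) • y₀ := by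
  have hy : y₀ ≠ 0 := fun h => ha₀ (by simp [h])
  let g := fderiv ℝ (fderiv ℝ E) y₀
  have hgs : ∀ u w, g u w = g w u := hE.hessian_symm hy
  have horth : ∀ e f : V, a e = 0 → a f = 0 → g f e = 0 → g f (B e e) = 0 := by
    intro e f he hf hfe
    obtain ⟨l, c, hlc⟩ := hB.exists_apply_self_eq hE ha₀ hcrit he
    rw [hlc, map_add, map_smul, map_smul, hfe,
      show g f y₀ = 0 from hessian_crit_of_mem_ker hE ha₀ hcrit hf]
    simp
  have hsym : ∀ u z w : V, a z = 0 → a w = 0 → g z (B u w) = g w (B u z) :=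
    fun u z w hz hw => hB.hessian_crit_symm hE ha₀ hcrit hz hw
  have hdiag : ∀ e : V, a e = 0 → g e (B e e) = 0 := by
    intro e he
    rcases eq_or_ne e 0 with rfl | hne
    · simp
    obtain ⟨f, hf, hfe, hff⟩ := exists_orthogonal hE ha₀ hdim hne
    change g f e = 0 at hfe
    change g f f = g e e at hff
    have hef : g e f = 0 := by rw [hgs, hfe]
    -- Equal lengths make e + f and e − f orthogonal. With the mixed terms zero, the two instances
    -- say that the values on (e,e,e) and (f,f,f) have zero difference and zero sum.
    have h1 := horth (e + f) (e - f) (by simp [he, hf]) (by simp [he, hf])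
      (by simp [hef, hfe, hff])
    have h2 := horth (e - f) (e + f) (by simp [he, hf]) (by simp [he, hf])
      (by simp [hef, hfe, hff])
    have h3 := horth e f he hf hfe
    have h4 := horth f e hf he hef
    have h5 : g e (B e f) = 0 := by rw [hsym e e f he hf, h3]
    have h6 : g f (B e f) = 0 := by rw [hB.symm, hsym f f e hf he, h4]
    have h5' : g e (B f e) = 0 := by rw [hB.symm, h5]
    have h6' : g f (B f e) = 0 := by rw [hB.symm, h6]
    simp [h3, h4, h5, h6, h5', h6'] at h1 h2
    linarith
  have hall : ∀ w : V, a w = 0 → g w (B h h) = 0 := by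
    intro w hw
    rcases eq_or_ne h 0 with rfl | hne
    · simp
    have hp : g h h ≠ 0 := (hE.posDef y₀ hy h hne).ne'
    have h1 := horth h (w - (g w h / g h h) • h) hh (by simp [hh, hw]) (by
      rw [map_sub, map_smul, sub_apply, smul_apply, smul_eq_mul, div_mul_cancel₀ _ hp, sub_self])
    simpa [hdiag h hh] using h1
  by_contra hne
  -- The difference of the two sides lies in ker a, hence is g₀-orthogonal to both `B h h` and y₀,
  -- and so to itself.
  have hv : a (a y₀ • B h h - a (B h h) • y₀) = 0 := by simp [mul_comm]
  have h1 := hE.posDef y₀ hy _ (sub_ne_zero.2 hne)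
  rw [map_sub (fderiv ℝ (fderiv ℝ E) y₀ _), map_smul, map_smul,
    show fderiv ℝ (fderiv ℝ E) y₀ _ (B h h) = 0 from hall _ hv,
    hessian_crit_of_mem_ker hE ha₀ hcrit hv] at h1
  simp at h1

theorem apply_eq (hB : HasQuadraticGradient E a B) (hE : IsMinkowskiEnergy E) (ha₀ : a y₀ ≠ 0)
    (hcrit : ∀ w, 2 * E y₀ * a w = a y₀ * fderiv ℝ E y₀ w)
    [FiniteDimensional ℝ V] (hdim : 3 ≤ Module.finrank ℝ V)
    {h w : V} (hh : a h = 0) (hw : a w = 0) : a y₀ • B h w = a (B h w) • y₀ := by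
  have h1 := hB.apply_self_eq hE ha₀ hcrit hdim (h := h + w) (by simp [hh, hw])
  have h2 := hB.apply_self_eq hE ha₀ hcrit hdim hh
  have h3 := hB.apply_self_eq hE ha₀ hcrit hdim hw
  simp only [map_add, add_apply, smul_add, add_smul, h2, h3, hB.symm w h] at h1
  have h4 : (2 : ℝ) • (a y₀ • B h w) = (2 : ℝ) • (a (B h w) • y₀) := by
    rw [two_smul, two_smul]
    have : ∀ p q r s : V, p + q + (q + r) = p + s + (s + r) → q + q = s + s := by
      intro p q r s hpq
      have := congrArg (fun x => x - p - r) hpq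
      convert this using 1 <;> abel
    exact this _ _ _ _ h1
  exact smul_right_injective V (two_ne_zero' ℝ) h4

/-- For w in ker a, B(y,w) is a multiple of y₀ with coefficient proportional to g₀(y,w) by
`linearForm_apply`. Then dE_y(B(y,w)) = a(y) dE_y(w) makes dE_y(w) proportional to g₀(y,w); the case
w = y eliminates the unknown dE_y(y₀). -/
theorem fderiv_eq_of_ne (hB : HasQuadraticGradient E a B) (hE : IsMinkowskiEnergy E)
    (ha₀ : a y₀ ≠ 0) (hcrit : ∀ w, 2 * E y₀ * a w = a y₀ * fderiv ℝ E y₀ w)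
    [FiniteDimensional ℝ V] (hdim : 3 ≤ Module.finrank ℝ V) {y : V} (hay : a y ≠ 0) (w : V) :
    fderiv ℝ (fderiv ℝ E) y₀ y y * fderiv ℝ E y w =
      2 * E y * fderiv ℝ (fderiv ℝ E) y₀ y w := by
  have hy₀ : y₀ ≠ 0 := fun h => ha₀ (by simp [h])
  have hy : y ≠ 0 := fun h => hay (by simp [h])
  have hE₀ := (hE.pos hy₀).ne'
  let g := fderiv ℝ (fderiv ℝ E) y₀
  have hgs : ∀ u w, g u w = g w u := hE.hessian_symm hy₀
  have hdec : ∀ v : V, a (v - (a v / a y₀) • y₀) = 0 := fun v => by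
    simp [div_mul_cancel₀ _ ha₀]
  have hgy₀ : ∀ v, a y₀ * g v y₀ = 2 * E y₀ * a v := fun v => by
    rw [hcrit v, show g v y₀ = _ from hE.hessian_apply_self hy₀ v]
  have hkerw : ∀ w, a w = 0 →
      a y₀ * g y w * fderiv ℝ E y y₀ = 2 * E y₀ * a y * fderiv ℝ E y w := by
    intro w hw
    have h1 := hB.fderiv_apply hE hy w
    have h2 : a y₀ • B y w = a (B y w) • y₀ := by
      have h3 := hB.apply_eq hE ha₀ hcrit hdim (hdec y) hw
      rw [map_sub, map_smul, sub_apply, smul_apply, hB.apply_crit hE ha₀ hcrit, hw] at h3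
      simpa using h3
    have h3 := congrArg (fderiv ℝ E y) h2
    rw [map_smul, map_smul, smul_eq_mul, smul_eq_mul, h1] at h3
    have h4 : 2 * E y₀ * a (B y w) = a y₀ ^ 2 * g y w := hB.linearForm_apply hE ha₀ hcrit y w
    apply mul_left_cancel₀ ha₀
    linear_combination (-fderiv ℝ E y y₀) * h4 - 2 * E y₀ * h3
  -- The relation also holds for w = y₀, since a(y₀) g₀(y,y₀) = 2E(y₀) a(y), hence for all w.
  have hall : ∀ w, a y₀ * g y w * fderiv ℝ E y y₀ = 2 * E y₀ * a y * fderiv ℝ E y w := by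
    intro w
    have h1 := hkerw _ (hdec w)
    simp only [map_sub, map_smul, smul_eq_mul] at h1
    linear_combination h1 + (a w / a y₀) * fderiv ℝ E y y₀ * hgy₀ y
  have hself := hall y
  rw [hE.fderiv_apply_self hy] at hself
  change g y y * fderiv ℝ E y w = 2 * E y * g y w
  apply mul_left_cancel₀ (mul_ne_zero (mul_ne_zero two_ne_zero hE₀) hay)
  linear_combination (-g y y) * hall w + g y w * hself

theorem fderiv_eq (hB : HasQuadraticGradient E a B) (hE : IsMinkowskiEnergy E) (ha₀ : a y₀ ≠ 0)
    (hcrit : ∀ w, 2 * E y₀ * a w = a y₀ * fderiv ℝ E y₀ w)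
    [FiniteDimensional ℝ V] (hdim : 3 ≤ Module.finrank ℝ V) {y : V} (hy : y ≠ 0) (w : V) :
    fderiv ℝ (fderiv ℝ E) y₀ y y * fderiv ℝ E y w =
      2 * E y * fderiv ℝ (fderiv ℝ E) y₀ y w := by
  by_cases hay : a y = 0
  -- Vectors of ker a are approached along y + t y₀, where a is non-zero for t ≠ 0.
  · have hline : ContinuousAt (fun t : ℝ => y + t • y₀) 0 := by fun_prop
    have hy0 : y + (0 : ℝ) • y₀ ≠ 0 := by simpa using hy
    have h1 : ContinuousAt (fun t : ℝ => E (y + t • y₀)) 0 :=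
      ContinuousAt.comp (f := fun t : ℝ => y + t • y₀) (hE.contDiffAt hy0).continuousAt hline
    have h2 : ContinuousAt (fun t : ℝ => fderiv ℝ E (y + t • y₀) w) 0 :=
      (ContinuousAt.comp (f := fun t : ℝ => y + t • y₀)
        (hE.contDiffAt_fderiv hy0).continuousAt hline).clm_apply continuousAt_const
    have h3 := eq_of_forall_ne_zero_eq
      (f := fun t : ℝ => fderiv ℝ (fderiv ℝ E) y₀ (y + t • y₀) (y + t • y₀) *
        fderiv ℝ E (y + t • y₀) w)
      (g := fun t : ℝ => 2 * E (y + t • y₀) * fderiv ℝ (fderiv ℝ E) y₀ (y + t • y₀) w)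
      (by fun_prop) ((continuousAt_const.mul h1).mul (by fun_prop))
      (fun t ht => hB.fderiv_eq_of_ne hE ha₀ hcrit hdim (by simp [hay, ha₀, ht]) w)
    simpa using h3
  · exact hB.fderiv_eq_of_ne hE ha₀ hcrit hdim hay w

/-- By `fderiv_eq` the quotient E(y) / g₀(y,y) has zero derivative on the connected complement of
the origin. -/
theorem exists_eq_const_mul (hB : HasQuadraticGradient E a B) (hE : IsMinkowskiEnergy E)
    (ha₀ : a y₀ ≠ 0) (hcrit : ∀ w, 2 * E y₀ * a w = a y₀ * fderiv ℝ E y₀ w)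
    [FiniteDimensional ℝ V] (hdim : 3 ≤ Module.finrank ℝ V)
    : ∃ c : ℝ, ∀ y, y ≠ 0 → E y = c * fderiv ℝ (fderiv ℝ E) y₀ y y := by
  have hy₀ : y₀ ≠ 0 := fun h => ha₀ (by simp [h])
  let g := fderiv ℝ (fderiv ℝ E) y₀
  have hgs : ∀ u w, g u w = g w u := hE.hessian_symm hy₀
  have hpos : ∀ y, y ≠ 0 → g y y ≠ 0 := fun y hy => (hE.posDef y₀ hy₀ y hy).ne'
  have hconn : IsConnected ({0}ᶜ : Set V) :=
    isConnected_compl_singleton_of_one_lt_rank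
      (Module.one_lt_rank_of_one_lt_finrank (by omega)) 0
  have hd : ∀ y : V, y ≠ 0 → HasFDerivAt (fun y => E y / g y y) (0 : V →L[ℝ] ℝ) y := by
    intro y hy
    have h1 := (g.hasFDerivAt (x := y)).clm_apply (hasFDerivAt_id y)
    have h2 := (hE.hasFDerivAt hy).mul
      (HasDerivAt.comp_hasFDerivAt (h₂ := fun x : ℝ => x⁻¹) (f := fun y => g y (id y)) y
        (hasDerivAt_inv (hpos y hy)) h1)
    have h3 : HasFDerivAt (fun y => E y / g y y) _ y := h2
    refine h3.congr_fderiv ?_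
    ext w
    have h4 : g y y * fderiv ℝ E y w = 2 * E y * g y w := hB.fderiv_eq hE ha₀ hcrit hdim hy w
    have h5 := hpos y hy
    simp [hgs w y]
    field_simp
    linarith
  obtain ⟨c, hc⟩ := isOpen_compl_singleton.exists_is_const_of_fderiv_eq_zero
    hconn.isPreconnected (fun y hy => (hd y hy).differentiableAt.differentiableWithinAt)
    (fun y hy => (hd y hy).fderiv)
  refine ⟨c, fun y hy => ?_⟩
  rw [← hc y hy]
  exact (div_mul_cancel₀ _ (hpos y hy)).symm

/-- The energy is a quadratic form as soon as `E • grad a` is quadratic for some linear form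
`a ≠ 0`. -/
theorem exists_eq_quadratic (hB : HasQuadraticGradient E a B) (hE : IsMinkowskiEnergy E)
    [FiniteDimensional ℝ V] (hdim : 3 ≤ Module.finrank ℝ V) (ha : a ≠ 0) :
    ∃ γ : V →L[ℝ] V →L[ℝ] ℝ, (∀ u w, γ u w = γ w u) ∧ ∀ y, y ≠ 0 → E y = γ y y := by
  obtain ⟨y₀, ha₀, hcrit⟩ := hE.exists_linearForm_eq_fderiv ha
  have hy₀ : y₀ ≠ 0 := fun h => ha₀ (by simp [h])
  obtain ⟨c, hc⟩ := hB.exists_eq_const_mul hE ha₀ hcrit hdim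
  exact ⟨c • fderiv ℝ (fderiv ℝ E) y₀, fun u w => by simp [hE.hessian_symm hy₀ u w],
    fun y hy => by simp [hc y hy]⟩

end HasQuadraticGradient

/-! ### Partial derivatives and the fundamental tensor in coordinates -/

section Coordinates

variable {n : ℕ}

theorem pd_congr {m : ℕ} {i : Fin m} {f g : Vec m → ℝ} {x : Vec m} (h : f =ᶠ[nhds x] g) :
    pd i f x = pd i g x := by
  rw [pd, pd, h.fderiv_eq]

theorem eventually_ne_zero {y : Vec n} (hy : y ≠ 0) : ∀ᶠ z in nhds y, z ≠ 0 :=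
  isOpen_compl_singleton.mem_nhds hy

theorem contDiffAt_pd {f : Vec n → ℝ} {y : Vec n} (hf : ContDiffAt ℝ ∞ f y) (i : Fin n) :
    ContDiffAt ℝ ∞ (pd i f) y :=
  (hf.fderiv_right (m := ∞) (by simp)).clm_apply contDiffAt_const

theorem pd_sub {f g : Vec n → ℝ} {y : Vec n} (hf : ContDiffAt ℝ ∞ f y) (hg : ContDiffAt ℝ ∞ g y)
    (i : Fin n) : pd i (fun z => f z - g z) y = pd i f y - pd i g y := by
  simp only [pd]
  rw [fderiv_fun_sub (hf.differentiableAt (by simp)) (hg.differentiableAt (by simp))]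
  rfl

theorem pd_clm_apply {W : Type*} [NormedAddCommGroup W] [NormedSpace ℝ W]
    {f : Vec n → W →L[ℝ] ℝ} {y : Vec n} (hf : DifferentiableAt ℝ f y) (w : W) (i : Fin n) :
    pd i (fun z => f z w) y = fderiv ℝ f y (EuclideanSpace.single i 1) w := by
  rw [pd, fderiv_clm_apply hf (differentiableAt_const w)]
  simp

theorem pd_pd {f : Vec n → ℝ} {y : Vec n} (hf : ContDiffAt ℝ ∞ f y) (i j : Fin n) :
    pd j (pd i f) y =
      fderiv ℝ (fderiv ℝ f) y (EuclideanSpace.single j 1) (EuclideanSpace.single i 1) :=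
  pd_clm_apply ((hf.fderiv_right (m := ∞) (by simp)).differentiableAt (by simp)) _ j

theorem pd_pd_pd {f : Vec n → ℝ} {y : Vec n} (hf : ContDiffAt ℝ ∞ f y) (i j k : Fin n) :
    pd k (pd j (pd i f)) y =
      fderiv ℝ (fderiv ℝ (fderiv ℝ f)) y (EuclideanSpace.single k 1) (EuclideanSpace.single j 1)
        (EuclideanSpace.single i 1) := by
  have hf2 := (hf.fderiv_right (m := ∞) (by simp)).fderiv_right (m := ∞) (by simp)
  have h1 : pd j (pd i f) =ᶠ[nhds y] fun z =>
      fderiv ℝ (fderiv ℝ f) z (EuclideanSpace.single j 1) (EuclideanSpace.single i 1) := by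
    have hev : ∀ᶠ z in nhds y, ContDiffAt ℝ 2 f z :=
      (hf.of_le (m := 2) ENat.LEInfty.out).eventually (by simp)
    filter_upwards [hev] with z hz
    exact pd_clm_apply ((hz.fderiv_right (m := 1) (by norm_num)).differentiableAt (by simp)) _ j
  rw [pd_congr h1, pd_clm_apply (f := fun z => fderiv ℝ (fderiv ℝ f) z (EuclideanSpace.single j 1))
    ((hf2.differentiableAt (by simp)).clm_apply (differentiableAt_const _)),
    fderiv_clm_apply (hf2.differentiableAt (by simp)) (differentiableAt_const _)]
  simp

theorem clm_eq_sum_single (φ : Vec n →L[ℝ] ℝ) (w : Vec n) :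
    φ w = ∑ i, w i * φ (EuclideanSpace.single i 1) := by
  conv_lhs => rw [← (EuclideanSpace.basisFun (Fin n) ℝ).sum_repr w]
  simp

theorem clm_ext_single {W : Type*} [NormedAddCommGroup W] [NormedSpace ℝ W] {φ ψ : Vec n →L[ℝ] W}
    (h : ∀ i, φ (EuclideanSpace.single i 1) = ψ (EuclideanSpace.single i 1)) : φ = ψ := by
  have := (EuclideanSpace.basisFun (Fin n) ℝ).toBasis.ext (f₁ := φ.toLinearMap)
    (f₂ := ψ.toLinearMap) (fun i => by simpa using h i)
  exact ContinuousLinearMap.coe_injective this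

/-- A function that is homogeneous of degree two and has vanishing third derivatives away from the
origin is a quadratic form. -/
theorem exists_bilinear_of_pd_pd_pd_eq_zero (hn : 2 ≤ n) {f : Vec n → ℝ}
    (hf : ContDiffOn ℝ ∞ f {0}ᶜ) (hhom : ∀ (t : ℝ) (y : Vec n), 0 < t → f (t • y) = t ^ 2 * f y)
    (h3 : ∀ y, y ≠ 0 → ∀ i j k, pd k (pd j (pd i f)) y = 0) :
    ∃ b : Vec n →L[ℝ] Vec n →L[ℝ] ℝ, (∀ u w, b u w = b w u) ∧ ∀ y, y ≠ 0 → 2 * f y = b y y := by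
  have hfa : ∀ y : Vec n, y ≠ 0 → ContDiffAt ℝ ∞ f y := fun y hy =>
    hf.contDiffAt (isOpen_compl_singleton.mem_nhds hy)
  have hconn : IsConnected ({0}ᶜ : Set (Vec n)) :=
    isConnected_compl_singleton_of_one_lt_rank
      (Module.one_lt_rank_of_one_lt_finrank (by simp; omega)) 0
  -- The Hessian is constant on the connected set of non-zero vectors; its constant value is the
  -- form, by Euler's relation applied twice.
  obtain ⟨b, hb⟩ := isOpen_compl_singleton.exists_is_const_of_fderiv_eq_zero
    (f := fderiv ℝ (fderiv ℝ f)) (𝕜 := ℝ) hconn.isPreconnected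
    (fun y hy => ((((hfa y hy).fderiv_right (m := ∞) (by simp)).fderiv_right (m := ∞)
      (by simp)).differentiableAt (by simp)).differentiableWithinAt)
    (fun y hy => clm_ext_single fun k => clm_ext_single fun j => clm_ext_single fun i => by
      rw [← pd_pd_pd (hfa y hy), h3 y hy]; rfl)
  obtain ⟨y₁, hy₁⟩ := hconn.nonempty
  refine ⟨b, fun u w => ?_, fun y hy => ?_⟩
  · rw [← hb y₁ hy₁]
    exact ((hfa y₁ hy₁).isSymmSndFDerivAt (by simpa using ENat.LEInfty.out)) u w
  · rw [← hb y hy, hessian_apply_self_of_homogeneous hf hhom hy,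
      fderiv_apply_self_of_homogeneous hf hhom hy]

theorem contDiffAt_det {W : Type*} [NormedAddCommGroup W] [NormedSpace ℝ W]
    {A : W → Matrix (Fin n) (Fin n) ℝ} {y : W}
    (hA : ∀ i j, ContDiffAt ℝ ∞ (fun z => A z i j) y) : ContDiffAt ℝ ∞ (fun z => (A z).det) y := by
  simp only [Matrix.det_apply]
  exact ContDiffAt.sum fun σ _ => ContDiffAt.const_smul _ (contDiffAt_prod fun i _ => hA _ _)

theorem contDiffAt_matrix_inv {W : Type*} [NormedAddCommGroup W] [NormedSpace ℝ W]
    {A : W → Matrix (Fin n) (Fin n) ℝ} {y : W}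
    (hA : ∀ i j, ContDiffAt ℝ ∞ (fun z => A z i j) y) (hdet : (A y).det ≠ 0) (i j : Fin n) :
    ContDiffAt ℝ ∞ (fun z => (A z)⁻¹ i j) y := by
  simp only [Matrix.inv_def, Ring.inverse_eq_inv', Matrix.smul_apply, Matrix.adjugate_apply,
    smul_eq_mul]
  refine ((contDiffAt_det hA).inv hdet).mul (contDiffAt_det fun k l => ?_)
  simp only [Matrix.updateRow_apply]
  split_ifs
  · exact contDiffAt_const
  · exact hA k l

variable {E : Vec n → Vec n → ℝ} {x y : Vec n}

theorem gCoord_apply (hE : IsMinkowskiEnergy (E x)) (hy : y ≠ 0) (i j : Fin n) :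
    gCoord E x y i j =
      fderiv ℝ (fderiv ℝ (E x)) y (EuclideanSpace.single j 1) (EuclideanSpace.single i 1) :=
  pd_pd (hE.contDiffAt hy) i j

theorem sum_gCoord_mul (hE : IsMinkowskiEnergy (E x)) (hy : y ≠ 0) (i : Fin n) (w : Vec n) :
    ∑ j, gCoord E x y i j * w j =
      fderiv ℝ (fderiv ℝ (E x)) y (EuclideanSpace.single i 1) w := by
  rw [clm_eq_sum_single]
  refine Finset.sum_congr rfl fun j _ => ?_
  rw [gCoord_apply hE hy, hE.hessian_symm hy, mul_comm]

theorem gCoord_det_ne_zero (hE : IsMinkowskiEnergy (E x)) (hy : y ≠ 0) :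
    (gCoord E x y).det ≠ 0 := by
  intro h0
  obtain ⟨v, hv, hv0⟩ := Matrix.exists_mulVec_eq_zero_iff.2 h0
  have hne : WithLp.toLp 2 v ≠ (0 : Vec n) := by simpa using hv
  have h1 := hE.posDef y hy _ hne
  rw [hE.hessian_symm hy, clm_eq_sum_single, Finset.sum_eq_zero] at h1
  · exact lt_irrefl _ h1
  · intro i _
    rw [hE.hessian_symm hy, ← sum_gCoord_mul hE hy]
    have := congrFun hv0 i
    simp only [Matrix.mulVec, dotProduct, Pi.zero_apply] at this
    simp [this]

/-- By homogeneity the covector dE is g_y(y,·), so raising its index returns y. -/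
theorem sum_inv_gCoord_mul (hE : IsMinkowskiEnergy (E x)) (hy : y ≠ 0) (l : Fin n) :
    ∑ m, (gCoord E x y)⁻¹ l m * pd m (E x) y = y l := by
  have h1 : ∀ m, pd m (E x) y = (gCoord E x y).mulVec (fun i => y i) m := fun m => by
    rw [pd, ← hE.hessian_apply_self hy, ← sum_gCoord_mul hE hy]
    rfl
  simp only [h1]
  change (gCoord E x y)⁻¹.mulVec _ l = _
  rw [Matrix.mulVec_mulVec, Matrix.nonsing_inv_mul _ (isUnit_iff_ne_zero.2
    (gCoord_det_ne_zero hE hy)), Matrix.one_mulVec]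

theorem contDiffAt_gCoord_inv (hE : IsMinkowskiEnergy (E x)) (hy : y ≠ 0) (i j : Fin n) :
    ContDiffAt ℝ ∞ (fun z => (gCoord E x z)⁻¹ i j) y :=
  contDiffAt_matrix_inv
    (fun i j => contDiffAt_pd (contDiffAt_pd (hE.contDiffAt hy) i) j)
    (gCoord_det_ne_zero hE hy) i j

end Coordinates

/-! ### The spray under a conformal change -/

section ConformalSpray

variable {n : ℕ} {E : Vec n → Vec n → ℝ} {β : Vec n → ℝ} {x y : Vec n}

theorem pd_fst_eq (hsm : ContDiffAt ℝ ∞ (fun p : Vec n × Vec n => E p.1 p.2) (x, y))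
    (k : Fin n) : pd k (fun x' => E x' y) x =
      fderiv ℝ (fun p : Vec n × Vec n => E p.1 p.2) (x, y) (EuclideanSpace.single k 1, 0) := by
  have h1 := (hsm.differentiableAt (by simp)).hasFDerivAt
  have h2 := (hasFDerivAt_id (𝕜 := ℝ) x).prodMk (hasFDerivAt_const y x)
  have h3 : HasFDerivAt (fun x' => E x' y) _ x :=
    HasFDerivAt.comp (g := fun p : Vec n × Vec n => E p.1 p.2) x h1 h2
  rw [pd, h3.fderiv]
  rfl

theorem differentiableAt_fst (hsm : ContDiffAt ℝ ∞ (fun p : Vec n × Vec n => E p.1 p.2) (x, y)) :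
    DifferentiableAt ℝ (fun x' => E x' y) x :=
  (hsm.comp x (f := fun x' => (x', y)) (by fun_prop)).differentiableAt (by simp)

/-- Smoothness in y of an x-derivative comes from joint smoothness, through the derivative of E on
the product. -/
theorem contDiffAt_pd_fst
    (hsm : ∀ y, y ≠ 0 → ContDiffAt ℝ ∞ (fun p : Vec n × Vec n => E p.1 p.2) (x, y))
    (hy : y ≠ 0) (k : Fin n) :
    ContDiffAt ℝ ∞ (fun z => pd k (fun x' => E x' z) x) y := by
  have h1 : ContDiffAt ℝ ∞ (fun z => fderiv ℝ (fun p : Vec n × Vec n => E p.1 p.2) (x, z)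
      (EuclideanSpace.single k 1, 0)) y :=
    (((hsm y hy).fderiv_right (m := ∞) (by simp)).comp y (f := fun z => (x, z))
      (by fun_prop)).clm_apply contDiffAt_const
  refine h1.congr_of_eventuallyEq ?_
  filter_upwards [eventually_ne_zero hy] with z hz using pd_fst_eq (hsm z hz) k

theorem contDiffAt_spray
    (hsm : ∀ y, y ≠ 0 → ContDiffAt ℝ ∞ (fun p : Vec n × Vec n => E p.1 p.2) (x, y))
    (hE : IsMinkowskiEnergy (E x)) (hy : y ≠ 0) (l : Fin n) : ContDiffAt ℝ ∞ (spray E l x) y := by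
  refine contDiffAt_const.mul (ContDiffAt.sum fun m _ => ?_)
  refine (contDiffAt_gCoord_inv hE hy l m).mul (ContDiffAt.sub (ContDiffAt.sum fun k _ => ?_)
    (contDiffAt_pd_fst hsm hy m))
  exact ContDiffAt.mul (by fun_prop) (contDiffAt_pd (contDiffAt_pd_fst hsm hy k) m)

/-- The component `E gˡᵐ ∂ₘβ - (yᵏ ∂ₖβ) yˡ` of the difference of the geodesic sprays of `E` and
`e^{2β} E`. -/
noncomputable def sprayDefect (E : Vec n → Vec n → ℝ) (β : Vec n → ℝ) (x : Vec n) (l : Fin n) (y : Vec n) : ℝ :=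
  E x y * ∑ m, (gCoord E x y)⁻¹ l m * pd m β x - fderiv ℝ β x y * y l

/-- The factor e^{2β} cancels against the inverse metric. The product rule leaves the covector 2
dβ(y) ∂ₘE − 2E ∂ₘβ, and raising its index gives 2 dβ(y) y − 2E grad β. -/
theorem spray_conformal
    (hsm : ∀ y, y ≠ 0 → ContDiffAt ℝ ∞ (fun p : Vec n × Vec n => E p.1 p.2) (x, y))
    (hE : IsMinkowskiEnergy (E x)) (hβ : DifferentiableAt ℝ β x) (hy : y ≠ 0) (l : Fin n) :
    spray (fun x y => Real.exp (β x) ^ 2 * E x y) l x y =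
      spray E l x y - sprayDefect E β x l y := by
  have hc : HasFDerivAt (fun x => Real.exp (β x) ^ 2)
      ((2 * Real.exp (β x) ^ 2) • fderiv ℝ β x) x := by
    refine (hβ.hasFDerivAt.exp.pow 2).congr_fderiv ?_
    ext w
    simp
    ring
  have hcx : Real.exp (β x) ^ 2 ≠ 0 := pow_ne_zero 2 (Real.exp_ne_zero _)
  have hpd : ∀ k z, z ≠ 0 → pd k (fun x' => Real.exp (β x') ^ 2 * E x' z) x =
      Real.exp (β x) ^ 2 * (2 * pd k β x * E x z + pd k (fun x' => E x' z) x) := by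
    intro k z hz
    rw [pd, (hc.fun_mul (differentiableAt_fst (hsm z hz)).hasFDerivAt).fderiv]
    simp [pd]
    ring
  have hpdy : ∀ m k, pd m (fun z => pd k (fun x' => Real.exp (β x') ^ 2 * E x' z) x) y =
      Real.exp (β x) ^ 2 *
        (2 * pd k β x * pd m (E x) y + pd m (fun z => pd k (fun x' => E x' z) x) y) := by
    intro m k
    have h1 : (fun z => pd k (fun x' => Real.exp (β x') ^ 2 * E x' z) x) =ᶠ[nhds y] fun z =>
        Real.exp (β x) ^ 2 * (2 * pd k β x * E x z + pd k (fun x' => E x' z) x) := by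
      filter_upwards [eventually_ne_zero hy] with z hz using hpd k z hz
    have h2 := ((contDiffAt_pd_fst hsm hy k).differentiableAt (by simp)).hasFDerivAt
    rw [pd_congr h1, pd, ((((hE.hasFDerivAt hy).const_mul (2 * pd k β x)).fun_add h2).const_mul
      (Real.exp (β x) ^ 2)).fderiv]
    rfl
  have hg : gCoord (fun x y => Real.exp (β x) ^ 2 * E x y) x y =
      Real.exp (β x) ^ 2 • gCoord E x y := by
    have h1 : ∀ i z, pd i (fun y => Real.exp (β x) ^ 2 * E x y) z =
        Real.exp (β x) ^ 2 * pd i (E x) z := by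
      intro i z
      rw [pd, show (fun y => Real.exp (β x) ^ 2 * E x y) = Real.exp (β x) ^ 2 • E x from rfl,
        fderiv_const_smul_field]
      rfl
    ext i j
    simp only [gCoord, Matrix.of_apply, Matrix.smul_apply, smul_eq_mul]
    rw [show pd i (fun y => Real.exp (β x) ^ 2 * E x y) = Real.exp (β x) ^ 2 • pd i (E x) from
      funext (h1 i), pd, fderiv_const_smul_field]
    rfl
  have hginv : (gCoord (fun x y => Real.exp (β x) ^ 2 * E x y) x y)⁻¹ =
      (Real.exp (β x) ^ 2)⁻¹ • (gCoord E x y)⁻¹ := by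
    rw [hg]
    exact Matrix.inv_smul' (gCoord E x y) (Units.mk0 _ hcx) (isUnit_iff_ne_zero.2 (gCoord_det_ne_zero hE hy))
  have hlin : fderiv ℝ β x y = ∑ k, y k * pd k β x := clm_eq_sum_single _ _
  have hterm : ∀ m, (gCoord (fun x y => Real.exp (β x) ^ 2 * E x y) x y)⁻¹ l m *
      ((∑ k, y k * pd m (fun y' => pd k (fun x' => Real.exp (β x') ^ 2 * E x' y') x) y) -
        pd m (fun x' => Real.exp (β x') ^ 2 * E x' y) x) =
      (gCoord E x y)⁻¹ l m * ((∑ k, y k * pd m (fun y' => pd k (fun x' => E x' y') x) y) -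
        pd m (fun x' => E x' y) x) +
      2 * fderiv ℝ β x y * ((gCoord E x y)⁻¹ l m * pd m (E x) y) -
      2 * E x y * ((gCoord E x y)⁻¹ l m * pd m β x) := by
    intro m
    rw [hginv, hpd m y hy]
    have h1 : ∑ k, y k * pd m (fun y' => pd k (fun x' => Real.exp (β x') ^ 2 * E x' y') x) y =
        Real.exp (β x) ^ 2 * (2 * fderiv ℝ β x y * pd m (E x) y +
          ∑ k, y k * pd m (fun y' => pd k (fun x' => E x' y') x) y) := by
      rw [hlin, Finset.mul_sum, Finset.sum_mul, ← Finset.sum_add_distrib, Finset.mul_sum]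
      refine Finset.sum_congr rfl fun k _ => ?_
      rw [hpdy]
      ring
    rw [h1, Matrix.smul_apply, smul_eq_mul]
    field_simp
    ring
  simp only [spray, sprayDefect]
  rw [Finset.sum_congr rfl fun m _ => hterm m, Finset.sum_sub_distrib, Finset.sum_add_distrib,
    ← Finset.mul_sum, ← Finset.mul_sum, sum_inv_gCoord_mul hE hy]
  ring

theorem contDiffAt_sprayDefect (hE : IsMinkowskiEnergy (E x)) (hy : y ≠ 0) (l : Fin n) :
    ContDiffAt ℝ ∞ (sprayDefect E β x l) y := by
  refine ((hE.contDiffAt hy).mul (ContDiffAt.sum fun m _ =>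
    (contDiffAt_gCoord_inv hE hy l m).mul contDiffAt_const)).sub (ContDiffAt.mul ?_ ?_) <;> fun_prop

theorem pd_pd_pd_sprayDefect
    (hsm : ∀ y, y ≠ 0 → ContDiffAt ℝ ∞ (fun p : Vec n × Vec n => E p.1 p.2) (x, y))
    (hE : IsMinkowskiEnergy (E x)) (hβ : DifferentiableAt ℝ β x) (hy : y ≠ 0) {l i j k : Fin n}
    (hP : mixedCurvature (fun x y => Real.exp (β x) ^ 2 * E x y) l i j k x y =
      mixedCurvature E l i j k x y) :
    pd k (pd j (pd i (sprayDefect E β x l))) y = 0 := by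
  have h1 : ∀ z, z ≠ 0 → pd i (spray (fun x y => Real.exp (β x) ^ 2 * E x y) l x) z =
      pd i (spray E l x) z - pd i (sprayDefect E β x l) z := fun z hz => by
    rw [← pd_sub (contDiffAt_spray hsm hE hz l) (contDiffAt_sprayDefect hE hz l)]
    apply pd_congr
    filter_upwards [eventually_ne_zero hz] with u hu using spray_conformal hsm hE hβ hu l
  have h2 : ∀ z, z ≠ 0 → pd j (pd i (spray (fun x y => Real.exp (β x) ^ 2 * E x y) l x)) z =
      pd j (pd i (spray E l x)) z - pd j (pd i (sprayDefect E β x l)) z := fun z hz => by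
    rw [← pd_sub (contDiffAt_pd (contDiffAt_spray hsm hE hz l) i)
      (contDiffAt_pd (contDiffAt_sprayDefect hE hz l) i)]
    apply pd_congr
    filter_upwards [eventually_ne_zero hz] with u hu using h1 u hu
  have h3 : pd k (pd j (pd i (spray (fun x y => Real.exp (β x) ^ 2 * E x y) l x))) y =
      pd k (pd j (pd i (spray E l x))) y - pd k (pd j (pd i (sprayDefect E β x l))) y := by
    rw [← pd_sub (contDiffAt_pd (contDiffAt_pd (contDiffAt_spray hsm hE hy l) i) j)
      (contDiffAt_pd (contDiffAt_pd (contDiffAt_sprayDefect hE hy l) i) j)]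
    apply pd_congr
    filter_upwards [eventually_ne_zero hy] with u hu using h2 u hu
  simp only [mixedCurvature] at hP
  linarith

theorem hessian_smul (hE : IsMinkowskiEnergy (E x))
    (t : ℝ) (ht : 0 < t) (hy : y ≠ 0) (u w : Vec n) :
    fderiv ℝ (fderiv ℝ (E x)) (t • y) u w = fderiv ℝ (fderiv ℝ (E x)) y u w := by
  have hty : ∀ z : Vec n, z ≠ 0 → t • z ≠ 0 := fun z hz => smul_ne_zero ht.ne' hz
  have hs : ∀ z : Vec n, HasFDerivAt (fun z : Vec n => t • z)
      (t • ContinuousLinearMap.id ℝ (Vec n)) z := fun z => (hasFDerivAt_id z).const_smul t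
  have h1 : ∀ z, z ≠ 0 → ∀ w, t * fderiv ℝ (E x) (t • z) w = t ^ 2 * fderiv ℝ (E x) z w := by
    intro z hz w
    have := fderiv_unique_of_eqOn hz ((hE.hasFDerivAt (hty z hz)).comp z (hs z))
      ((hE.hasFDerivAt hz).const_mul (t ^ 2)) (fun v _ => hE.homogeneous t v ht) w
    simpa using this
  have h2 := fderiv_unique_of_eqOn hy
    ((((hE.hasFDerivAt_fderiv (hty y hy)).comp y (hs y)).clm_apply
      (hasFDerivAt_const w y)).const_mul t)
    (((hE.hasFDerivAt_fderiv hy).clm_apply (hasFDerivAt_const w y)).const_mul (t ^ 2))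
    (fun v hv => h1 v hv w) u
  simp at h2
  have ht2 : t ^ 2 ≠ 0 := by positivity
  apply mul_left_cancel₀ ht2
  linarith

theorem sprayDefect_smul (hE : IsMinkowskiEnergy (E x))
    (t : ℝ) (y : Vec n) (ht : 0 < t) (l : Fin n) :
    sprayDefect E β x l (t • y) = t ^ 2 * sprayDefect E β x l y := by
  rcases eq_or_ne y 0 with rfl | hy
  · have h0 : E x 0 = 0 := by
      have := hE.homogeneous 2 0 two_pos
      simp at this
      linarith
    simp [sprayDefect, h0]
  · have hg : gCoord E x (t • y) = gCoord E x y := by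
      ext i j
      rw [gCoord_apply hE (smul_ne_zero ht.ne' hy), gCoord_apply hE hy, hessian_smul hE t ht hy]
    simp only [sprayDefect, hg, hE.homogeneous t y ht, map_smul, smul_eq_mul, PiLp.smul_apply]
    ring

/-- Invariance of the mixed curvature under the conformal change with factor `e^β` forces the
energy to be a quadratic form at every point where the derivative of `β` does not vanish. -/
theorem exists_quadratic_of_mixedCurvature_eq
    (hsm : ∀ y, y ≠ 0 → ContDiffAt ℝ ∞ (fun p : Vec n × Vec n => E p.1 p.2) (x, y))
    (hE : IsMinkowskiEnergy (E x)) (hn : 3 ≤ n) (hβ : DifferentiableAt ℝ β x)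
    (hβ0 : fderiv ℝ β x ≠ 0)
    (hP : ∀ y, y ≠ 0 → ∀ l i j k, mixedCurvature (fun x y => Real.exp (β x) ^ 2 * E x y) l i j k x y =
      mixedCurvature E l i j k x y) :
    ∃ γ : Vec n →L[ℝ] Vec n →L[ℝ] ℝ, (∀ u w, γ u w = γ w u) ∧ ∀ y, y ≠ 0 → E x y = γ y y := by
  have hex : ∀ l, ∃ b : Vec n →L[ℝ] Vec n →L[ℝ] ℝ, (∀ u w, b u w = b w u) ∧
      ∀ y, y ≠ 0 → 2 * sprayDefect E β x l y = b y y := fun l =>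
    exists_bilinear_of_pd_pd_pd_eq_zero (by omega)
      (fun y hy => (contDiffAt_sprayDefect hE hy l).contDiffWithinAt)
      (fun t y ht => sprayDefect_smul hE t y ht l)
      (fun y hy i j k => pd_pd_pd_sprayDefect hsm hE hβ hy (hP y hy l i j k))
  choose b hbs hb using hex
  let a := fderiv ℝ β x
  -- The forms `b l` represent 2E grad β − 2 dβ(y) y; adding a(u) w + a(w) u removes the second
  -- term, so that B(y,y) = 2E grad β.
  let A : Vec n →L[ℝ] Vec n →L[ℝ] Vec n := a.smulRight (ContinuousLinearMap.id ℝ (Vec n))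
  let B : Vec n →L[ℝ] Vec n →L[ℝ] Vec n :=
    ∑ l, (ContinuousLinearMap.compL ℝ (Vec n) ℝ (Vec n)
      (ContinuousLinearMap.toSpanSingleton ℝ (EuclideanSpace.single l (1 : ℝ)))) ∘L b l + A + A.flip
  have hBa : ∀ u w i, B u w i = b i u w + a u * w i + a w * u i := by
    intro u w i
    simp [B, A, Pi.single_apply]
  have hQ : HasQuadraticGradient (E x) a B := by
    refine ⟨fun u w => ?_, fun y hy w => ?_⟩
    · ext i
      rw [hBa, hBa, hbs]
      ring
    · have h1 : ∀ i, B y y i = 2 * E x y * ∑ m, (gCoord E x y)⁻¹ i m * pd m β x := fun i => by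
        rw [hBa, ← hb i y hy, sprayDefect]
        ring
      have h2 : ∀ j, fderiv ℝ (fderiv ℝ (E x)) y (EuclideanSpace.single j 1) (B y y) =
          2 * E x y * pd j β x := fun j => by
        rw [← sum_gCoord_mul hE hy]
        have h3 : ∀ i, gCoord E x y j i * B y y i = 2 * E x y *
            (gCoord E x y j i * ((gCoord E x y)⁻¹.mulVec fun m => pd m β x) i) := fun i => by
          rw [h1]
          simp only [Matrix.mulVec, dotProduct]
          ring
        rw [Finset.sum_congr rfl fun i _ => h3 i, ← Finset.mul_sum]
        change 2 * E x y * (gCoord E x y).mulVec _ j = _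
        rw [Matrix.mulVec_mulVec, Matrix.mul_nonsing_inv _ (isUnit_iff_ne_zero.2
          (gCoord_det_ne_zero hE hy)), Matrix.one_mulVec]
      rw [hE.hessian_symm hy, clm_eq_sum_single, clm_eq_sum_single a, Finset.mul_sum]
      refine Finset.sum_congr rfl fun j _ => ?_
      rw [hE.hessian_symm hy, h2, pd]
      ring
  exact hQ.exists_eq_quadratic hE (by simpa using hn) hβ0

end ConformalSpray

/-! ### Finsler metrics in the charts of the manifold -/

section Charts

open Bundle

variable {n : ℕ} {M : Type*} [TopologicalSpace M] [ChartedSpace (Vec n) M]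
  {F : TangentBundle (𝓡 n) M → ℝ}

theorem coordEnergy_conformalChange (α : M → ℝ) (c : OpenPartialHomeomorph M (Vec n)) :
    coordEnergy (conformalChange α F) c =
      fun x y => Real.exp (α (c.symm x)) ^ 2 * coordEnergy F c x y := by
  funext x y
  simp only [coordEnergy, conformalChange]
  ring

variable [IsManifold (𝓡 n) ∞ M]

/-- Identifies induced fibre coordinates with the tangent bundle trivialization, whose smoothness
and fibrewise linearity then transfer to `coordEnergy`. -/
theorem mfderiv_chart_symm (p : M) {x : Vec n} (hx : x ∈ (chartAt (Vec n) p).target) :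
    mfderiv (𝓡 n) (𝓡 n) (chartAt (Vec n) p).symm x =
      (trivializationAt (Vec n) (TangentSpace (𝓡 n) : M → Type _) p).symmL ℝ
        ((chartAt (Vec n) p).symm x) := by
  have hq := (chartAt (Vec n) p).map_target hx
  have : IsManifold (𝓡 n) 1 M := IsManifold.of_le (n := ∞) (by simp)
  rw [TangentBundle.symmL_trivializationAt hq]
  simp only [mfld_simps, mfderivWithin_univ]
  let Φ : Vec n → (Vec n →L[ℝ] Vec n) := fun z => mfderiv (𝓡 n) (𝓡 n) (chartAt (Vec n) p).symm z
  exact congrArg Φ ((chartAt (Vec n) p).right_inv hx).symm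

theorem exists_equiv_eq_mfderiv_chart_symm (p : M) {x : Vec n}
    (hx : x ∈ (chartAt (Vec n) p).target) :
    ∃ L : Vec n ≃L[ℝ] Vec n,
      ∀ y : Vec n, mfderiv (𝓡 n) (𝓡 n) (chartAt (Vec n) p).symm x y = L y := by
  have : IsManifold (𝓡 n) 1 M := IsManifold.of_le (n := ∞) (by simp)
  let e := trivializationAt (Vec n) (TangentSpace (𝓡 n) : M → Type _) p
  have hb : (chartAt (Vec n) p).symm x ∈ e.baseSet := by
    rw [TangentBundle.trivializationAt_baseSet]
    exact (chartAt (Vec n) p).map_target hx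
  refine ⟨(e.continuousLinearEquivAt ℝ _ hb).symm, fun y => ?_⟩
  rw [mfderiv_chart_symm p hx]
  exact e.symmL_apply (R := ℝ) hb y

theorem mk_mfderiv_chart_symm (p : M) {x : Vec n} (hx : x ∈ (chartAt (Vec n) p).target)
    (y : Vec n) :
    (⟨(chartAt (Vec n) p).symm x, mfderiv (𝓡 n) (𝓡 n) (chartAt (Vec n) p).symm x y⟩ :
        TangentBundle (𝓡 n) M) =
      (trivializationAt (Vec n) (TangentSpace (𝓡 n) : M → Type _) p).toOpenPartialHomeomorph.symm
        ((chartAt (Vec n) p).symm x, y) := by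
  have : IsManifold (𝓡 n) 1 M := IsManifold.of_le (n := ∞) (by simp)
  let e := trivializationAt (Vec n) (TangentSpace (𝓡 n) : M → Type _) p
  have hb : (chartAt (Vec n) p).symm x ∈ e.baseSet := by
    rw [TangentBundle.trivializationAt_baseSet]
    exact (chartAt (Vec n) p).map_target hx
  rw [← e.mk_symm hb, ← e.symmL_apply (R := ℝ) hb, mfderiv_chart_symm p hx]
  rfl

theorem contDiffAt_coordEnergy (hF : IsFinslerMetric F) (p : M) {x y : Vec n}
    (hx : x ∈ (chartAt (Vec n) p).target) (hy : y ≠ 0) :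
    ContDiffAt ℝ ∞ (fun z : Vec n × Vec n => coordEnergy F (chartAt (Vec n) p) z.1 z.2)
      (x, y) := by
  have : IsManifold (𝓡 n) 1 M := IsManifold.of_le (n := ∞) (by simp)
  let c := chartAt (Vec n) p
  let e := trivializationAt (Vec n) (TangentSpace (𝓡 n) : M → Type _) p
  have hbase : e.baseSet = c.source := TangentBundle.trivializationAt_baseSet p
  have hopen : IsOpen (c.target ×ˢ ({0}ᶜ : Set (Vec n))) :=
    c.open_target.prod isOpen_compl_singleton
  have hpair : ContMDiffOn 𝓘(ℝ, Vec n × Vec n) ((𝓡 n).prod 𝓘(ℝ, Vec n)) ∞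
      (fun z : Vec n × Vec n => (c.symm z.1, z.2)) (c.target ×ˢ {0}ᶜ) := by
    refine ContMDiffOn.prodMk ?_ contDiff_snd.contMDiff.contMDiffOn
    exact (contMDiffOn_chart_symm (I := 𝓡 n) (n := ∞) (x := p)).comp
      contDiff_fst.contMDiff.contMDiffOn fun z hz => hz.1
  have h1 : ContMDiffOn 𝓘(ℝ, Vec n × Vec n) (𝓡 n).tangent ∞
      (fun z : Vec n × Vec n => e.toOpenPartialHomeomorph.symm (c.symm z.1, z.2))
      (c.target ×ˢ {0}ᶜ) :=
    (Trivialization.contMDiffOn_symm (IB := 𝓡 n) (n := ∞) e).comp hpair fun z hz => by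
      rw [e.target_eq, hbase]
      exact ⟨c.map_target hz.1, Set.mem_univ _⟩
  have h2 : ContMDiffOn 𝓘(ℝ, Vec n × Vec n) (𝓡 n).tangent ∞
      (fun z : Vec n × Vec n =>
        (⟨c.symm z.1, mfderiv (𝓡 n) (𝓡 n) c.symm z.1 z.2⟩ : TangentBundle (𝓡 n) M))
      (c.target ×ˢ {0}ᶜ) := h1.congr fun z hz => mk_mfderiv_chart_symm p hz.1 z.2
  have h3 := hF.smooth.comp h2 (fun z hz => by
    obtain ⟨L, hL⟩ := exists_equiv_eq_mfderiv_chart_symm p hz.1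
    intro h0
    have h0' : L z.2 = 0 := (hL z.2).symm.trans h0
    exact hz.2 (by simpa using h0'))
  have h4 := (h3.contDiffOn.contDiffAt (hopen.mem_nhds (x := (x, y)) ⟨hx, hy⟩))
  exact contDiffAt_const.mul (h4.pow 2)

theorem isMinkowskiEnergy_coordEnergy (hF : IsFinslerMetric F) (p : M) {x : Vec n}
    (hx : x ∈ (chartAt (Vec n) p).target) :
    IsMinkowskiEnergy (coordEnergy F (chartAt (Vec n) p) x) := by
  have hsm : ∀ y, y ≠ 0 → ContDiffAt ℝ ∞ (coordEnergy F (chartAt (Vec n) p) x) y := fun y hy =>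
    (contDiffAt_coordEnergy hF p hx hy).comp y (f := fun z => (x, z)) (by fun_prop)
  obtain ⟨L, hL⟩ := exists_equiv_eq_mfderiv_chart_symm p hx
  have hEL : coordEnergy F (chartAt (Vec n) p) x =
      energyAt F ((chartAt (Vec n) p).symm x) ∘ L := by
    funext y
    simp only [coordEnergy, energyAt, Function.comp_apply]
    rw [hL]
  refine ⟨fun y hy => (hsm y hy).contDiffWithinAt, fun t y ht => ?_, fun y hy w hw => ?_⟩
  · rw [hEL]
    simp only [energyAt, Function.comp_apply, map_smul]
    have := hF.homogeneous ((chartAt (Vec n) p).symm x) (L y) t ht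
    erw [this]
    ring
  · have h1 : (fun z => fderiv ℝ (coordEnergy F (chartAt (Vec n) p) x) z w) =
        (fun z => fderiv ℝ (energyAt F ((chartAt (Vec n) p).symm x)) z (L w)) ∘ L := by
      funext z
      rw [hEL, L.comp_right_fderiv]
      rfl
    have h2 : fderiv ℝ (fun z => fderiv ℝ (coordEnergy F (chartAt (Vec n) p) x) z w) y w =
        fundamentalForm F ((chartAt (Vec n) p).symm x) (L y) (L w) (L w) := by
      rw [h1, L.comp_right_fderiv]
      rfl
    have h3 : fderiv ℝ (fun z => fderiv ℝ (coordEnergy F (chartAt (Vec n) p) x) z w) y w =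
        fderiv ℝ (fderiv ℝ (coordEnergy F (chartAt (Vec n) p) x)) y w w := by
      rw [fderiv_clm_apply (((hsm y hy).fderiv_right (m := ∞) (by simp)).differentiableAt
        (by simp)) (differentiableAt_const w)]
      simp
    rw [← h3, h2]
    exact hF.stronglyConvex _ _ (by simpa using hy) _ (by simpa using hw)

end Charts

/-! ### From fibrewise quadratic forms to a smooth Riemannian metric -/

section Main

open Bundle

variable {n : ℕ} {M : Type*} [TopologicalSpace M] [ChartedSpace (Vec n) M]
  [IsManifold (𝓡 n) ∞ M] {F : TangentBundle (𝓡 n) M → ℝ}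

set_option synthInstance.maxHeartbeats 200000 in
/-- A Finsler metric whose energy in the chart at `p` is, over the open set `Ω`, a quadratic form
in the fibre coordinates is Riemannian over `Ω`. -/
theorem isRiemannianOn_of_quadratic (hF : IsFinslerMetric F) (p : M) {Ω : Set (Vec n)}
    (hΩ : Ω ⊆ (chartAt (Vec n) p).target)
    (hquad : ∀ x ∈ Ω, ∃ γ : Vec n →L[ℝ] Vec n →L[ℝ] ℝ, (∀ u w, γ u w = γ w u) ∧
      ∀ y, y ≠ 0 → coordEnergy F (chartAt (Vec n) p) x y = γ y y) :
    IsRiemannianOn F ((chartAt (Vec n) p).source ∩ (chartAt (Vec n) p) ⁻¹' Ω) := by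
  have : IsManifold (𝓡 n) 1 M := IsManifold.of_le (n := ∞) (by simp)
  let c := chartAt (Vec n) p
  let E := coordEnergy F c
  have hE0 : ∀ x ∈ c.target, E x 0 = 0 := by
    intro x hx
    have := (isMinkowskiEnergy_coordEnergy hF p hx).homogeneous 2 0 two_pos
    rw [smul_zero] at this
    change E x 0 = 2 ^ 2 * E x 0 at this
    linarith
  choose! G hGs hG using hquad
  have hG' : ∀ x ∈ Ω, ∀ y, E x y = G x y y := by
    intro x hx y
    rcases eq_or_ne y 0 with rfl | hy
    · rw [hE0 x (hΩ hx)]; simp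
    · exact hG x hx y hy
  -- The forms `G x` are chosen point by point; polarization expresses them through E, which makes
  -- them smooth in x.
  have hGpol : ∀ x ∈ Ω, ∀ u w, G x u w = (1 / 2) * (E x (u + w) - E x u - E x w) := by
    intro x hx u w
    rw [hG' x hx, hG' x hx, hG' x hx]
    simp only [map_add, add_apply, hGs x hx w u]
    ring
  have hEsm : ∀ y, ContDiffOn ℝ ∞ (fun x => E x y) Ω := by
    intro y x hx
    rcases eq_or_ne y 0 with rfl | hy
    · exact contDiffWithinAt_const.congr (fun z hz => hE0 z (hΩ hz)) (hE0 x (hΩ hx))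
    · exact ((contDiffAt_coordEnergy hF p (hΩ hx) hy).comp x (f := fun z => (z, y))
        (by fun_prop)).contDiffWithinAt
  -- The factor 2 is due to γ(v,v) = F² = 2E.
  have hGsm : ContDiffOn ℝ ∞ (fun x => (2 : ℝ) • G x) Ω := by
    rw [contDiffOn_clm_apply]
    intro u
    rw [contDiffOn_clm_apply]
    intro w
    refine (((hEsm (u + w)).sub (hEsm u)).sub (hEsm w)).congr fun x hx => ?_
    simp only [smul_apply, smul_eq_mul, hGpol x hx u w]
    ring
  let U := c.source ∩ c ⁻¹' Ω
  let e := trivializationAt (Vec n) (TangentSpace (𝓡 n) : M → Type _) p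
  let e' := trivializationAt (Vec n →L[ℝ] Vec n →L[ℝ] ℝ)
    (fun q : M => TangentSpace (𝓡 n) q →L[ℝ] TangentSpace (𝓡 n) q →L[ℝ] ℝ) p
  have hbase : e.baseSet = c.source := TangentBundle.trivializationAt_baseSet p
  have hbase' : ∀ q ∈ c.source, q ∈ e'.baseSet := by
    intro q hq
    have hq' : q ∈ e.baseSet := hbase ▸ hq
    exact ⟨hq', hq', Set.mem_univ _⟩
  have heval : ∀ q ∈ U, ∀ y z : Vec n,
      e'.symm q ((2 : ℝ) • G (c q)) (e.symm q y) (e.symm q z) = 2 * G (c q) y z := by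
    intro q hq y z
    have hq' : q ∈ e.baseSet := hbase ▸ hq.1
    have h1 := e'.apply_mk_symm (hbase' q hq.1) ((2 : ℝ) • G (c q))
    have h2 := congrArg (fun r => r.2 y z) h1
    simp only [e', hom_trivializationAt_apply] at h2
    rw [inCoordinates_apply_eq₂ hq' hq' (Set.mem_univ _)] at h2
    simpa using h2
  have hsurj : ∀ q ∈ U, ∀ v : TangentSpace (𝓡 n) q, ∃ y : Vec n, e.symm q y = v := by
    intro q hq v
    have hq' : q ∈ e.baseSet := hbase ▸ hq.1
    exact ⟨(e.continuousLinearEquivAt ℝ q hq') v,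
      (e.continuousLinearEquivAt ℝ q hq').symm_apply_apply v⟩
  have henergy : ∀ q ∈ U, ∀ y : Vec n, (1 / 2) * F ⟨q, e.symm q y⟩ ^ 2 = G (c q) y y := by
    intro q hq y
    have hq' : q ∈ e.baseSet := hbase ▸ hq.1
    rw [← hG' (c q) hq.2]
    simp only [E, coordEnergy]
    rw [mk_mfderiv_chart_symm p (c.map_source hq.1), c.left_inv hq.1, ← e.mk_symm hq']
  refine ⟨fun q => e'.symm q ((2 : ℝ) • G (c q)), ?_, fun q hq => ⟨?_, ?_, ?_⟩⟩
  · have h1 : ContMDiffOn (𝓡 n) ((𝓡 n).prod 𝓘(ℝ, Vec n →L[ℝ] Vec n →L[ℝ] ℝ)) ∞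
        (fun q => (q, (2 : ℝ) • G (c q))) U := by
      refine contMDiffOn_id.prodMk ?_
      exact hGsm.contMDiffOn.comp ((contMDiffOn_chart (I := 𝓡 n) (n := ∞) (x := p)).mono
        Set.inter_subset_left) fun q hq => hq.2
    have h2 := (Trivialization.contMDiffOn_symm (IB := 𝓡 n) (n := ∞) e').comp h1 fun q hq => by
      rw [e'.target_eq]
      exact ⟨hbase' q hq.1, Set.mem_univ _⟩
    exact h2.congr fun q hq => e'.mk_symm (hbase' q hq.1) _
  · intro v w
    obtain ⟨y, rfl⟩ := hsurj q hq v
    obtain ⟨z, rfl⟩ := hsurj q hq w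
    rw [heval q hq, heval q hq, hGs (c q) hq.2]
  · intro v hv
    obtain ⟨y, rfl⟩ := hsurj q hq v
    have hq' : q ∈ e.baseSet := hbase ▸ hq.1
    have hy : y ≠ 0 := by
      rintro rfl
      exact hv ((e.continuousLinearEquivAt ℝ q hq').symm.map_zero)
    rw [heval q hq, ← hG' (c q) hq.2]
    exact mul_pos two_pos ((isMinkowskiEnergy_coordEnergy hF p (c.map_source hq.1)).pos hy)
  · intro v
    obtain ⟨y, rfl⟩ := hsurj q hq v
    rw [heval q hq, ← henergy q hq]
    rw [← mul_assoc, mul_one_div_cancel two_ne_zero, one_mul, Real.sqrt_sq (hF.nonneg _)]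

end Main

end Finsler

/-- The proof gives the stronger result that `F` is Riemannian near every point where the
derivative of `α` does not vanish: smoothness of `F` on all non-zero vectors and `3 ≤ n` suffice,
and the curvature assumption `hcurv` is not used. -/
theorem theoremA {n : ℕ} (hn : 3 ≤ n) {M : Type*} [TopologicalSpace M]
    [ChartedSpace (EuclideanSpace ℝ (Fin n)) M] [IsManifold (𝓡 n) ∞ M]
    (F : TangentBundle (𝓡 n) M → ℝ) (hF : Finsler.IsFinslerMetric F)
    (α : M → ℝ) (hα : ContMDiff (𝓡 n) 𝓘(ℝ, ℝ) ∞ α)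
    (p : M) (hp : mfderiv (𝓡 n) 𝓘(ℝ, ℝ) α p ≠ 0)
    (hcurv : Finsler.PositivelyCurvedIndicatrix F p)
    (hinv : Finsler.SameMixedCurvature (Finsler.conformalChange α F) F) :
    ∃ U : Set M, IsOpen U ∧ p ∈ U ∧ Finsler.IsRiemannianOn F U := by
  have : IsManifold (𝓡 n) 1 M := IsManifold.of_le (n := ∞) (by simp)
  let c := chartAt (Finsler.Vec n) p
  let β : Finsler.Vec n → ℝ := fun x => α (c.symm x)
  have hβsm : ContDiffOn ℝ ∞ β c.target :=
    (hα.comp_contMDiffOn (contMDiffOn_chart_symm (I := 𝓡 n) (n := ∞) (x := p))).contDiffOn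
  have hdβ : ContinuousOn (fderiv ℝ β) c.target :=
    hβsm.continuousOn_fderiv_of_isOpen c.open_target (by simp)
  -- The pointwise result needs dβ ≠ 0; continuity of dβ makes this an open condition.
  let Ω := c.target ∩ fderiv ℝ β ⁻¹' {0}ᶜ
  have hΩ : IsOpen Ω := hdβ.isOpen_inter_preimage c.open_target isOpen_compl_singleton
  have hpΩ : c p ∈ Ω := by
    refine ⟨c.map_source (mem_chart_source _ p), fun h0 => hp ?_⟩
    have hβd : MDifferentiableAt (𝓡 n) 𝓘(ℝ, ℝ) β (c p) :=
      ((hβsm.contDiffAt (c.open_target.mem_nhds (c.map_source (mem_chart_source _ p)))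
        ).differentiableAt (by simp)).mdifferentiableAt
    have hcd : MDifferentiableAt (𝓡 n) (𝓡 n) c p :=
      (mdifferentiable_chart (I := 𝓡 n) p).mdifferentiableAt (mem_chart_source _ p)
    have heq : α =ᶠ[nhds p] β ∘ c := by
      filter_upwards [c.open_source.mem_nhds (mem_chart_source _ p)] with q hq
      -- Near p one has α = β ∘ c, so dβ = 0 at c(p) would give dα = 0 at p by the chain rule.
      simp only [β, Function.comp_apply, c.left_inv hq]
    have h0' : fderiv ℝ β (c p) = 0 := h0
    rw [heq.mfderiv_eq, mfderiv_comp p hβd hcd, mfderiv_eq_fderiv, h0']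
    exact ContinuousLinearMap.zero_comp _
  refine ⟨c.source ∩ c ⁻¹' Ω, c.isOpen_inter_preimage hΩ, ⟨mem_chart_source _ p, hpΩ⟩,
    Finsler.isRiemannianOn_of_quadratic hF p Set.inter_subset_left fun x hx => ?_⟩
  refine Finsler.exists_quadratic_of_mixedCurvature_eq (β := β)
    (fun y hy => Finsler.contDiffAt_coordEnergy hF p hx.1 hy)
    (Finsler.isMinkowskiEnergy_coordEnergy hF p hx.1) hn
    ((hβsm.contDiffAt (c.open_target.mem_nhds hx.1)).differentiableAt (by simp)) hx.2
    fun y hy l i j k => ?_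
  have h1 := hinv c (IsManifold.chart_mem_maximalAtlas p) x hx.1 y hy l i j k
  rw [Finsler.coordEnergy_conformalChange] at h1
  exact h1
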